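/- Let $\mathbb D$ be the open unit disc. For $n\ge 0$ let $H^2(\mathbb D,\mathbb C^n)$ be the space of analytic $F:\mathbb D\to\mathbb C^n$ with $$\|F\|=\Big(\sup_{0<\rho<1}\frac1{2\pi}\int_0^{2\pi}\|F(\rho e^{it})\|^2\,dt\Big)^{1/2}<\infty ,$$ write $H^2(\mathbb D)=H^2(\mathbb D,\mathbb C)$, and let $S$ be the shift $(Sf)(z)=zf(z)$ on $H^2(\mathbb D)$. Let $H^\infty(\mathbb D,\mathcal L(\mathbb C^r,\mathbb C^n))$ be the space of bounded analytic functions on $\mathbb D$ with values in $\mathcal L(\mathbb C^r,\mathbb C^n)$, and $H^\infty_{r\times r}=H^\infty(\mathbb D,\mathcal L(\mathbb C^r,\mathbb C^r))$. Such a function $\Theta$ is called inner if, for almost every $t$, its boundary value $\Theta(e^{it})=\lim_{\rho\to1^-}\Theta(\rho e^{it})$ is an isometry. Let $m\ge 3$, $k\ge 1$ and $\gamma\in\{1,\dots,m-1\}$, and put $$\Sigma_{m,\gamma}^k(z)=\begin{pmatrix} 0_{\gamma\times(m-\gamma)} & z^{k+1}I_{\gamma}\\ z^{k}I_{m-\gamma}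 & 0_{(m-\gamma)\times\gamma}\end{pmatrix}.$$ **Theorem.** The formula $$T_m(f_0,\dots,f_{m-1})(z)=\sum_{l=0}^{m-1}z^l f_l(z^m)$$ defines an isometric isomorphism $T_m$ of $H^2(\mathbb D,\mathbb C^m)$ onto $H^2(\mathbb D)$. If $\mathcal M$ is a closed subspace of $H^2(\mathbb D)$ with $S^m\mathcal M\subset\mathcal M$ and $S^{km+\gamma}\mathcal M\subset\mathcal M$, then there are an $r$ with $0\le r\le m$ and an inner function $\Theta\in H^\infty(\mathbb D,\mathcal L(\mathbb C^r,\mathbb C^m))$ such that $$\mathcal M=T_m\big(\Theta H^2(\mathbb D,\mathbb C^r)\big)\quad\text{and}\quad \Theta^*\,\Sigma_{m,\gamma}^k\,\Theta\in H^\infty_{r\times r},$$ the latter meaning that $\Theta(e^{it})^*\,\Sigma_{m,\gamma}^k(e^{it})\,\Theta(e^{it})$ agrees for almost every $t$ with the boundary value of a function in $H^\infty_{r\times r}$. -/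

import Mathlib

open Set Filter Topology MeasureTheory
open scoped ContinuousLinearMap

noncomputable section

namespace Hardy

variable {E : Type*} [NormedAddCommGroup E] [NormedSpace ℂ E]

/-- The quadratic mean `(1/2π) ∫₀^{2π} ‖F(ρ e^{it})‖² dt`. -/
def meanSq (F : ℂ → E) (ρ : ℝ) : ℝ := Real.circleAverage (fun z => ‖F z‖ ^ 2) 0 ρ

lemma circleIntegrable_normSq {F : ℂ → E} (hF : DifferentiableOn ℂ F (Metric.ball 0 1))
    {ρ : ℝ} (hρ : ρ ∈ Ioo (0 : ℝ) 1) : CircleIntegrable (fun z => ‖F z‖ ^ 2) 0 ρ := by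
  apply ContinuousOn.circleIntegrable hρ.1.le
  have h := (hF.continuousOn.norm.pow 2)
  exact h.mono fun z hz => by
    simp only [mem_sphere_iff_norm, sub_zero, Metric.mem_ball, dist_zero_right] at hz ⊢
    linarith [hρ.2]

lemma meanSq_nonneg (F : ℂ → E) (ρ : ℝ) : 0 ≤ meanSq F ρ := by
  unfold meanSq Real.circleAverage
  rw [smul_eq_mul]
  refine mul_nonneg (inv_nonneg.2 Real.two_pi_pos.le) ?_
  exact intervalIntegral.integral_nonneg Real.two_pi_pos.le fun _ _ => by positivity

/-- If `‖H‖² ≤ a ‖F‖² + b ‖G‖²` on the disc then the same holds for the quadratic means. -/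
lemma meanSq_le {E' : Type*} [NormedAddCommGroup E'] [NormedSpace ℂ E']
    {H : ℂ → E'} {F G : ℂ → E} (hH : DifferentiableOn ℂ H (Metric.ball 0 1))
    (hF : DifferentiableOn ℂ F (Metric.ball 0 1)) (hG : DifferentiableOn ℂ G (Metric.ball 0 1))
    {a b : ℝ} (h : ∀ z ∈ Metric.ball (0 : ℂ) 1, ‖H z‖ ^ 2 ≤ a * ‖F z‖ ^ 2 + b * ‖G z‖ ^ 2)
    {ρ : ℝ} (hρ : ρ ∈ Ioo (0 : ℝ) 1) : meanSq H ρ ≤ a * meanSq F ρ + b * meanSq G ρ := by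
  have hiF := (circleIntegrable_normSq hF hρ).const_smul (a := a)
  have hiG := (circleIntegrable_normSq hG hρ).const_smul (a := b)
  have h1 : meanSq H ρ ≤ Real.circleAverage
      ((a • fun z => ‖F z‖ ^ 2) + (b • fun z => ‖G z‖ ^ 2)) 0 ρ := by
    apply Real.circleAverage_mono (circleIntegrable_normSq hH hρ) (hiF.add hiG)
    intro z hz
    have := h z (by
      simp only [mem_sphere_iff_norm, sub_zero, Metric.mem_ball, dist_zero_right] at hz ⊢
      rw [hz, abs_of_pos hρ.1]; exact hρ.2)
    simpa using this
  rw [Real.circleAverage_add hiF hiG, Real.circleAverage_smul, Real.circleAverage_smul] at h1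
  simpa [meanSq] using h1

variable (E) in
/-- The vector space underlying `H²(𝔻, E)`: analytic functions on the open unit disc with
bounded quadratic means.  A function on the disc is represented by its extension by `0` to `ℂ`,
so that two elements are equal exactly when they agree on the disc. -/
def submodule : Submodule ℂ (ℂ → E) where
  carrier := {F | DifferentiableOn ℂ F (Metric.ball 0 1) ∧ (∀ z ∉ Metric.ball (0 : ℂ) 1, F z = 0) ∧
    BddAbove (range fun ρ : Ioo (0 : ℝ) 1 => meanSq F ρ)}
  zero_mem' := by
    refine ⟨differentiableOn_const 0, fun _ _ => rfl, 0, ?_⟩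
    rintro _ ⟨ρ, rfl⟩
    simp [meanSq, Real.circleAverage]
  add_mem' := by
    rintro F G ⟨hF, hF0, A, hA⟩ ⟨hG, hG0, B, hB⟩
    refine ⟨hF.add hG, fun z hz => by simp [hF0 z hz, hG0 z hz], 2 * A + 2 * B, ?_⟩
    rintro _ ⟨ρ, rfl⟩
    have h := meanSq_le (hF.add hG) hF hG (a := 2) (b := 2) (fun z _ => by
      have := norm_add_le (F z) (G z)
      have h0 := norm_nonneg (F z + G z)
      simp only [Pi.add_apply]
      nlinarith [sq_nonneg (‖F z‖ - ‖G z‖)]) ρ.2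
    have h1 : meanSq F ρ ≤ A := hA ⟨ρ, rfl⟩
    have h2 : meanSq G ρ ≤ B := hB ⟨ρ, rfl⟩
    show meanSq (F + G) ρ ≤ _
    linarith
  smul_mem' := by
    rintro c F ⟨hF, hF0, A, hA⟩
    refine ⟨hF.const_smul c, fun z hz => by simp [hF0 z hz], ‖c‖ ^ 2 * A, ?_⟩
    rintro _ ⟨ρ, rfl⟩
    have h := meanSq_le (hF.const_smul c) hF hF (a := ‖c‖ ^ 2) (b := 0) (fun z _ => by
      simp [norm_smul, mul_pow]) ρ.2
    have h1 : meanSq F ρ ≤ A := hA ⟨ρ, rfl⟩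
    show meanSq (c • F) ρ ≤ _
    nlinarith [sq_nonneg ‖c‖]

variable (E) in
/-- The Hardy space `H²(𝔻, E)`. It is a type of its own, so that its topology is the one of the
Hardy norm below and not that of pointwise convergence. -/
def H2 : Type _ := submodule E

namespace H2

instance : AddCommGroup (H2 E) := inferInstanceAs (AddCommGroup (submodule E))
instance : Module ℂ (H2 E) := inferInstanceAs (Module ℂ (submodule E))

instance : CoeFun (H2 E) (fun _ => ℂ → E) := ⟨fun F => F.1⟩

/-- The Hardy norm `‖F‖ = (sup_{0<ρ<1} (1/2π) ∫₀^{2π} ‖F(ρ e^{it})‖² dt)^{1/2}`. -/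
instance : Norm (H2 E) := ⟨fun F => √(⨆ ρ : Ioo (0 : ℝ) 1, meanSq F ρ)⟩

@[ext] lemma ext {F G : H2 E} (h : ∀ z ∈ Metric.ball (0 : ℂ) 1, F z = G z) : F = G := by
  apply Subtype.ext
  funext z
  by_cases hz : z ∈ Metric.ball (0 : ℂ) 1
  · exact h z hz
  · rw [F.2.2.1 z hz, G.2.2.1 z hz]

@[simp] lemma zero_apply (z : ℂ) : (0 : H2 E) z = 0 := rfl
@[simp] lemma add_apply (F G : H2 E) (z : ℂ) : (F + G) z = F z + G z := rfl
@[simp] lemma neg_apply (F : H2 E) (z : ℂ) : (-F) z = -F z := rfl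
@[simp] lemma smul_apply (c : ℂ) (F : H2 E) (z : ℂ) : (c • F) z = c • F z := rfl

lemma differentiableOn (F : H2 E) : DifferentiableOn ℂ F (Metric.ball 0 1) := F.2.1

lemma norm_def (F : H2 E) : ‖F‖ = √(⨆ ρ : Ioo (0 : ℝ) 1, meanSq F ρ) := rfl

lemma norm_sq (F : H2 E) : ‖F‖ ^ 2 = ⨆ ρ : Ioo (0 : ℝ) 1, meanSq F ρ :=
  Real.sq_sqrt (Real.iSup_nonneg fun _ => meanSq_nonneg _ _)

lemma norm_nonneg' (F : H2 E) : 0 ≤ ‖F‖ := Real.sqrt_nonneg _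

lemma meanSq_le_norm_sq (F : H2 E) {ρ : ℝ} (hρ : ρ ∈ Ioo (0 : ℝ) 1) : meanSq F ρ ≤ ‖F‖ ^ 2 := by
  rw [norm_sq]
  exact le_ciSup F.2.2.2 (⟨ρ, hρ⟩ : Ioo (0 : ℝ) 1)

lemma norm_sq_le {F : H2 E} {C : ℝ} (h : ∀ ρ ∈ Ioo (0 : ℝ) 1, meanSq F ρ ≤ C) :
    ‖F‖ ^ 2 ≤ C := by
  rw [norm_sq]
  have : Nonempty (Ioo (0 : ℝ) 1) := ⟨⟨1 / 2, by norm_num, by norm_num⟩⟩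
  exact ciSup_le fun ρ => h ρ ρ.2

lemma eq_zero_of_norm {F : H2 E} (h : ‖F‖ = 0) : F = 0 := by
  have hne : ∀ z ∈ Metric.ball (0 : ℂ) 1, z ≠ 0 → F z = 0 := by
    intro z hz hz0
    have hρ : ‖z‖ ∈ Ioo (0 : ℝ) 1 := ⟨norm_pos_iff.2 hz0, by simpa using hz⟩
    have h0 : meanSq F ‖z‖ = 0 :=
      le_antisymm (by simpa [h] using meanSq_le_norm_sq F hρ) (meanSq_nonneg _ _)
    have hcont : Continuous fun t : ℝ => ‖F (circleMap 0 ‖z‖ t)‖ ^ 2 := by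
      refine (Continuous.norm ?_).pow 2
      refine F.differentiableOn.continuousOn.comp_continuous (continuous_circleMap 0 ‖z‖) ?_
      intro t
      simpa using hρ.2
    have hint : ∫ t in (0 : ℝ)..2 * Real.pi, ‖F (circleMap 0 ‖z‖ t)‖ ^ 2 = 0 := by
      have := h0
      unfold meanSq Real.circleAverage at this
      rw [smul_eq_mul, mul_eq_zero] at this
      exact this.resolve_left (inv_ne_zero Real.two_pi_pos.ne')
    by_contra hFz
    obtain ⟨t, ht, htz⟩ : ∃ t ∈ Ico (0 : ℝ) (2 * Real.pi), circleMap 0 ‖z‖ t = z := by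
      refine ⟨toIcoMod Real.two_pi_pos 0 z.arg, ?_, ?_⟩
      · simpa using toIcoMod_mem_Ico Real.two_pi_pos 0 z.arg
      · have hp := (periodic_circleMap (0 : ℂ) ‖z‖).sub_zsmul_eq (x := z.arg)
          (toIcoDiv Real.two_pi_pos 0 z.arg)
        rw [toIcoMod, hp, circleMap_zero, Complex.norm_mul_exp_arg_mul_I]
    have hpos : 0 < ∫ t in (0 : ℝ)..2 * Real.pi, ‖F (circleMap 0 ‖z‖ t)‖ ^ 2 := by
      apply intervalIntegral.integral_pos Real.two_pi_pos hcont.continuousOn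
        (fun _ _ => by positivity)
      exact ⟨t, ⟨ht.1, ht.2.le⟩, by rw [htz]; positivity⟩
    exact hpos.ne' hint
  ext z hz
  by_cases hz0 : z = 0
  · subst hz0
    have hc : ContinuousAt F 0 :=
      F.differentiableOn.continuousOn.continuousAt (Metric.ball_mem_nhds 0 one_pos)
    have h1 : Tendsto F (𝓝[≠] 0) (𝓝 (F 0)) := hc.tendsto.mono_left nhdsWithin_le_nhds
    have h2 : Tendsto F (𝓝[≠] 0) (𝓝 0) := by
      refine tendsto_const_nhds.congr' ?_
      filter_upwards [self_mem_nhdsWithin,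
        nhdsWithin_le_nhds (Metric.ball_mem_nhds (0 : ℂ) one_pos)] with w hw hw1
      exact (hne w hw1 hw).symm
    exact tendsto_nhds_unique h1 h2
  · exact hne z hz hz0

lemma norm_smul_le' (c : ℂ) (F : H2 E) : ‖c • F‖ ≤ ‖c‖ * ‖F‖ := by
  refine le_of_sq_le_sq ?_ (mul_nonneg (norm_nonneg c) F.norm_nonneg')
  refine norm_sq_le fun ρ hρ => ?_
  have h := meanSq_le (c • F).differentiableOn F.differentiableOn F.differentiableOn
    (a := ‖c‖ ^ 2) (b := 0) (fun z _ => by simp [norm_smul, mul_pow]) hρ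
  have := meanSq_le_norm_sq F hρ
  nlinarith [sq_nonneg ‖c‖]

lemma norm_add_le' (F G : H2 E) : ‖F + G‖ ≤ ‖F‖ + ‖G‖ := by
  rcases F.norm_nonneg'.eq_or_lt with hF | hF
  · rw [eq_zero_of_norm hF.symm, zero_add]
    linarith [(0 : H2 E).norm_nonneg']
  rcases G.norm_nonneg'.eq_or_lt with hG | hG
  · rw [eq_zero_of_norm hG.symm, add_zero]
    linarith [(0 : H2 E).norm_nonneg']
  refine le_of_sq_le_sq ?_ (by positivity)
  refine norm_sq_le fun ρ hρ => ?_
  have h := meanSq_le (F + G).differentiableOn F.differentiableOn G.differentiableOn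
    (a := 1 + ‖G‖ / ‖F‖) (b := 1 + ‖F‖ / ‖G‖) (fun z _ => by
      have h1 : ‖F z + G z‖ ^ 2 ≤ (‖F z‖ + ‖G z‖) ^ 2 := by
        gcongr; exact norm_add_le _ _
      have h2 : (1 + ‖G‖ / ‖F‖) * ‖F z‖ ^ 2 + (1 + ‖F‖ / ‖G‖) * ‖G z‖ ^ 2
          - (‖F z‖ + ‖G z‖) ^ 2 = (‖G‖ * ‖F z‖ - ‖F‖ * ‖G z‖) ^ 2 / (‖F‖ * ‖G‖) := by
        field_simp; ring
      have h3 : 0 ≤ (‖G‖ * ‖F z‖ - ‖F‖ * ‖G z‖) ^ 2 / (‖F‖ * ‖G‖) := by positivity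
      rw [add_apply]
      linarith) hρ
  have hF1 := mul_le_mul_of_nonneg_left (meanSq_le_norm_sq F hρ)
    (by positivity : 0 ≤ 1 + ‖G‖ / ‖F‖)
  have hG1 := mul_le_mul_of_nonneg_left (meanSq_le_norm_sq G hρ)
    (by positivity : 0 ≤ 1 + ‖F‖ / ‖G‖)
  have : (1 + ‖G‖ / ‖F‖) * ‖F‖ ^ 2 + (1 + ‖F‖ / ‖G‖) * ‖G‖ ^ 2 = (‖F‖ + ‖G‖) ^ 2 := by
    field_simp; ring
  linarith

lemma core : NormedSpace.Core ℂ (H2 E) where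
  norm_nonneg := norm_nonneg'
  norm_smul c F := by
    refine le_antisymm (norm_smul_le' c F) ?_
    rcases eq_or_ne c 0 with rfl | hc
    · simpa using ((0 : ℂ) • F).norm_nonneg'
    · have h := norm_smul_le' c⁻¹ (c • F)
      rw [smul_smul, inv_mul_cancel₀ hc, one_smul, norm_inv] at h
      exact (le_inv_mul_iff₀ (norm_pos_iff.2 hc)).1 h
  norm_triangle := norm_add_le'
  norm_eq_zero_iff F := by
    refine ⟨eq_zero_of_norm, ?_⟩
    rintro rfl
    refine le_antisymm ?_ (norm_nonneg' _)
    simpa using norm_smul_le' 0 (0 : H2 E)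

instance : NormedAddCommGroup (H2 E) := NormedAddCommGroup.ofCore core

instance : NormedSpace ℂ (H2 E) where
  norm_smul_le := norm_smul_le'

/-- The unilateral shift `(S F)(z) = z F(z)`. -/
def shift : Module.End ℂ (H2 E) where
  toFun F := ⟨fun z => z • F z, by
    have hd : DifferentiableOn ℂ (fun z => z • F z) (Metric.ball 0 1) :=
      differentiableOn_id.smul F.differentiableOn
    refine ⟨hd, fun z hz => by simp [F.2.2.1 z hz], ‖F‖ ^ 2, ?_⟩
    rintro _ ⟨ρ, rfl⟩
    refine le_trans ?_ (meanSq_le_norm_sq F ρ.2)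
    have h := meanSq_le hd F.differentiableOn F.differentiableOn (a := 1) (b := 0)
      (fun z hz => by
        have hz1 : ‖z‖ ≤ 1 := by simpa using (Metric.mem_ball.1 hz).le
        rw [norm_smul, mul_pow, zero_mul, add_zero]
        gcongr
        exact pow_le_one₀ (norm_nonneg z) hz1) ρ.2
    simpa using h⟩
  map_add' F G := by ext z _; exact smul_add _ _ _
  map_smul' c F := by ext z _; exact smul_comm _ _ _

end H2

/-- `ℂⁿ` with its Euclidean norm. -/
abbrev Cn (n : ℕ) : Type := EuclideanSpace ℂ (Fin n)

/-- `Φ ∈ H^∞(𝔻, L(ℂ^r, ℂ^n))`: `Φ` is analytic and bounded on the open unit disc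
(its values off the disc are irrelevant). -/
def MemHInf {r n : ℕ} (Φ : ℂ → Cn r →L[ℂ] Cn n) : Prop :=
  DifferentiableOn ℂ Φ (Metric.ball 0 1) ∧ ∃ C : ℝ, ∀ z ∈ Metric.ball (0 : ℂ) 1, ‖Φ z‖ ≤ C

/-- `L` is the boundary value `Φ(e^{it})`, i.e. the radial limit `lim_{ρ → 1⁻} Φ(ρ e^{it})`. -/
def HasBoundaryValue {r n : ℕ} (Φ : ℂ → Cn r →L[ℂ] Cn n) (t : ℝ) (L : Cn r →L[ℂ] Cn n) : Prop :=
  Tendsto (fun ρ : ℝ => Φ (circleMap 0 ρ t)) (𝓝[<] 1) (𝓝 L)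

/-- `Θ` is inner: it belongs to `H^∞` and `Θ(e^{it})` is an isometry for almost every `t`. -/
def IsInner {r n : ℕ} (Θ : ℂ → Cn r →L[ℂ] Cn n) : Prop :=
  MemHInf Θ ∧ ∀ᵐ t : ℝ, ∃ L, HasBoundaryValue Θ t L ∧ Isometry L

/-- The `m × m` matrix `Σ_{m,γ}^k` at the point `z`, with block form
`(0, z^{k+1} I_γ; z^k I_{m-γ}, 0)`: row `i`, column `j` holds `z^{k+1}` if `j = i + (m - γ)`,
`z^k` if `i = j + γ`, and `0` otherwise. -/
def sigmaMatrix (m γ k : ℕ) (z : ℂ) : Matrix (Fin m) (Fin m) ℂ :=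
  Matrix.of fun i j =>
    if (j : ℕ) + γ = i + m then z ^ (k + 1) else if (i : ℕ) = j + γ then z ^ k else 0

/-- `Θ^* Σ_{m,γ}^k Θ ∈ H^∞_{r×r}`: the function
`Θ(e^{it})^* Σ_{m,γ}^k(e^{it}) Θ(e^{it})`, defined for almost every `t`, is the boundary function
of some bounded analytic `r × r` matrix function on the disc. -/
def SigmaCompressionMemHInf {r m : ℕ} (γ k : ℕ) (Θ : ℂ → Cn r →L[ℂ] Cn m) : Prop :=
  ∃ Ψ : ℂ → Cn r →L[ℂ] Cn r, MemHInf Ψ ∧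
    ∀ᵐ t : ℝ, ∃ L, HasBoundaryValue Θ t L ∧
      HasBoundaryValue Ψ t
        (L.adjoint ∘L Matrix.toEuclideanCLM (𝕜 := ℂ) (sigmaMatrix m γ k (circleMap 0 1 t)) ∘L L)

/-- `Θ H²(𝔻, ℂ^r)`, as a set of elements of `H²(𝔻, ℂ^n)`. -/
def mulRange {r n : ℕ} (Θ : ℂ → Cn r →L[ℂ] Cn n) : Set (H2 (Cn n)) :=
  {G | ∃ F : H2 (Cn r), ∀ z ∈ Metric.ball (0 : ℂ) 1, G z = Θ z (F z)}

end Hardy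

end

/-!
The maps `(f₀, …, f_{m-1}) ↦ ∑ zˡ fₗ(zᵐ)` and `M ↦ T⁻¹ M` turn the statement into one about closed
shift invariant subspaces `N` of `H²(𝔻, ℂᵐ)`. By Parseval's identity (`hasSum_meanSq`) the Hardy
norm is the `ℓ²` norm of the Taylor coefficients (`H2.coeffEquiv`), and `T` merely rearranges the
coordinates of the coefficients along `ℕ × Fin m ≃ ℕ`; so it is an isometric isomorphism, it carries
the shift to `S^m`, and it carries multiplication by `Σ` to `S^{km+γ}` (`sum_pow_mul_sigmaMatrix`).

The subspace `N` is the closed span of the images, under the powers of the shift, of its wandering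
subspace `N ⊖ zN` (Wold, `eq_closure_iSup_range_of_wandering`), because the shift has no unitary
part. Hence `N` is the range of an isometry `X` of `H²(𝔻, ℂʳ)` commuting with the shifts, where `r`
is the dimension of the wandering subspace. Any such isometry is multiplication by an analytic
function `Θ` (`exists_multiplier`), and testing it on reproducing kernels gives `‖Θ(z)‖ ≤ 1`. It is
inner (`isInner_of_isometry`): its boundary values are contractions, and they preserve the norm of
each constant vector in the mean, hence almost everywhere. In particular a boundary value embeds
`ℂʳ` into `ℂᵐ`, which bounds the dimension of the wandering subspace by `m` (`le_of_wandering`).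

Invariance under `Σ` yields an isometry `Y` of `H²(𝔻, ℂʳ)` with `X Y = Σ X`. It commutes with the
shift, so it is multiplication by a bounded analytic `Ψ` with `Θ Ψ = Σ Θ` in the disc. On the
boundary `Θ` is isometric, so there `Ψ = Θ^* Σ Θ`.

The existence of radial limits almost everywhere (`ae_exists_tendsto_radial`) is needed for bounded
functions `f` only. A primitive `g` of `f` is Lipschitz, so it is differentiable along the circle at
almost every point `ζ`, and there `g'` has a radial limit: in the Cauchy formula for `g'(ρζ)` one
subtracts the kernel of the reflected point `ζ/ρ`, which bounds the kernel times the distance to `ζ`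
by a multiple of the Poisson kernel.
-/

noncomputable section

namespace Hardy

/-! ### Radial limits of bounded analytic functions -/

section Fatou

variable {E : Type*} [NormedAddCommGroup E] [NormedSpace ℂ E] [CompleteSpace E]

/-- The derivative inside the disc as an integral over the unit circle. Subtracting the kernel of
the reflected point `(conj z)⁻¹` does not change the integral, but makes the kernel comparable to
the Poisson kernel divided by `‖w - z‖`. -/
lemma two_pi_I_smul_deriv_eq_circleIntegral {u : ℂ → E} (hu : DiffContOnCl ℂ u (Metric.ball 0 1))
    {z z' : ℂ} (hz : z ∈ Metric.ball (0 : ℂ) 1) (hz' : 1 < ‖z'‖) :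
    (∮ w in C(0, 1), (((w - z) ^ 2)⁻¹ - ((w - z') ^ 2)⁻¹) • u w)
      = (2 * Real.pi * Complex.I : ℂ) • deriv u z := by
  have hcl : closure (Metric.ball (0 : ℂ) 1) = Metric.closedBall 0 1 :=
    closure_ball 0 one_ne_zero
  have hcu : ContinuousOn u (Metric.closedBall 0 1) := hu.continuousOn_ball
  have hsub : Metric.sphere (0 : ℂ) 1 ⊆ Metric.closedBall 0 1 := Metric.sphere_subset_closedBall
  have hz1 : ‖z‖ < 1 := by simpa using hz
  have hne : ∀ w ∈ Metric.sphere (0 : ℂ) 1, w - z ≠ 0 := by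
    intro w hw h
    rw [sub_eq_zero] at h
    simp [h] at hw
    linarith
  have hne' : ∀ w ∈ Metric.closedBall (0 : ℂ) 1, w - z' ≠ 0 := by
    intro w hw h
    rw [sub_eq_zero] at h
    simp [h] at hw
    linarith
  have hnhds : Metric.ball (0 : ℂ) 1 ∈ 𝓝 z := Metric.isOpen_ball.mem_nhds hz
  have hdz : DifferentiableAt ℂ u z := hu.differentiableOn.differentiableAt hnhds
  have hds : DiffContOnCl ℂ (dslope u z) (Metric.ball 0 1) := by
    refine ⟨(Complex.differentiableOn_dslope hnhds).2 hu.differentiableOn, ?_⟩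
    rw [hcl, continuousOn_dslope (mem_of_superset hnhds Metric.ball_subset_closedBall)]
    exact ⟨hcu, hdz⟩
  have h1 := hds.circleIntegral_sub_inv_smul hz
  rw [dslope_same] at h1
  have hi1 : CircleIntegrable (fun w => ((w - z) ^ 2)⁻¹ • u w) 0 1 := by
    apply ContinuousOn.circleIntegrable zero_le_one
    refine ContinuousOn.smul (ContinuousOn.inv₀ (by fun_prop) ?_) (hcu.mono hsub)
    intro w hw
    exact pow_ne_zero 2 (hne w hw)
  have hi0 : CircleIntegrable (fun w => ((w - z) ^ 2)⁻¹ • u z) 0 1 := by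
    apply ContinuousOn.circleIntegrable zero_le_one
    refine ContinuousOn.smul (ContinuousOn.inv₀ (by fun_prop) ?_) continuousOn_const
    intro w hw
    exact pow_ne_zero 2 (hne w hw)
  have hi2 : CircleIntegrable (fun w => ((w - z') ^ 2)⁻¹ • u w) 0 1 := by
    apply ContinuousOn.circleIntegrable zero_le_one
    refine ContinuousOn.smul (ContinuousOn.inv₀ (by fun_prop) ?_) (hcu.mono hsub)
    intro w hw
    exact pow_ne_zero 2 (hne' w (hsub hw))
  have h2 : (∮ w in C(0, 1), ((w - z') ^ 2)⁻¹ • u w) = 0 := by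
    apply DiffContOnCl.circleIntegral_eq_zero zero_le_one
    refine DiffContOnCl.smul (DifferentiableOn.diffContOnCl ?_) hu
    rw [hcl]
    intro w hw
    refine DifferentiableAt.differentiableWithinAt (DifferentiableAt.inv (by fun_prop) ?_)
    exact pow_ne_zero 2 (hne' w hw)
  have h3 : (∮ w in C(0, 1), ((w - z) ^ 2)⁻¹ • u z) = 0 := by
    rw [circleIntegral.integral_smul_const]
    have := circleIntegral.integral_sub_zpow_of_ne (n := -2) (by norm_num) 0 z 1
    have h4 : (∮ w in C(0, 1), ((w - z) ^ 2)⁻¹) = ∮ w in C(0, 1), (w - z) ^ (-2 : ℤ) := by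
      congr 1
    rw [h4, this, zero_smul]
  have h5 : (∮ w in C(0, 1), (w - z)⁻¹ • dslope u z w)
      = ∮ w in C(0, 1), (((w - z) ^ 2)⁻¹ • u w - ((w - z) ^ 2)⁻¹ • u z) := by
    apply circleIntegral.integral_congr zero_le_one
    intro w hw
    have hwz : w ≠ z := sub_ne_zero.1 (hne w hw)
    simp only
    rw [dslope_of_ne _ hwz, slope_def_module, ← smul_sub, smul_smul, sq, mul_inv]
  rw [h5, circleIntegral.integral_sub hi1 hi0, h3, sub_zero] at h1
  simp only [sub_smul]
  rw [circleIntegral.integral_sub hi1 hi2, h2, sub_zero, h1]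

/-- The reflected kernel at `z = ρ ζ`, multiplied by the distance to the boundary point `ζ`, is at
most four times the Poisson kernel. -/
lemma norm_reflectedKernel_mul_le {ρ : ℝ} (h0 : 0 < ρ) (h1 : ρ < 1) {ζ w : ℂ} (hζ : ‖ζ‖ = 1)
    (hw : ‖w‖ = 1) :
    ‖((w - ρ * ζ) ^ 2)⁻¹ - ((w - ρ⁻¹ * ζ) ^ 2)⁻¹‖ * ‖w - ζ‖
      ≤ 4 * ((1 - ρ ^ 2) / ‖w - ρ * ζ‖ ^ 2) := by
  have hρc : (ρ : ℂ) ≠ 0 := by exact_mod_cast h0.ne'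
  have hζ0 : ζ ≠ 0 := by intro h; simp [h] at hζ
  set a := w - ρ * ζ with ha
  rw [Complex.ofReal_inv]
  set b := w - (ρ : ℂ)⁻¹ * ζ with hb
  have hna : 1 - ρ ≤ ‖a‖ := by
    have := norm_sub_norm_le w (ρ * ζ)
    rw [hw, norm_mul, hζ, Complex.norm_real, Real.norm_of_nonneg h0.le, mul_one] at this
    exact this
  have ha0 : 0 < ‖a‖ := by linarith
  have hbn : ‖b‖ = ‖a‖ / ρ := by
    have hw0 : w ≠ 0 := by intro h; simp [h] at hw
    have hcw : (starRingEnd ℂ) w = w⁻¹ := by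
      rw [Complex.inv_def, Complex.normSq_eq_norm_sq, hw]; simp
    have hcz : (starRingEnd ℂ) ζ = ζ⁻¹ := by
      rw [Complex.inv_def, Complex.normSq_eq_norm_sq, hζ]; simp
    have hstar : (starRingEnd ℂ) a = -(ρ * b) / (w * ζ) := by
      rw [ha, hb, map_sub, map_mul, hcw, hcz, Complex.conj_ofReal]
      field_simp
      ring
    have h2 : ‖a‖ = ‖(starRingEnd ℂ) a‖ := (RCLike.norm_conj a).symm
    rw [h2, hstar, norm_div, norm_neg, norm_mul, norm_mul, hw, hζ, Complex.norm_real,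
      Real.norm_of_nonneg h0.le]
    field_simp
  have hb0 : 0 < ‖b‖ := by rw [hbn]; positivity
  have hac : a ≠ 0 := norm_pos_iff.1 ha0
  have hbc : b ≠ 0 := norm_pos_iff.1 hb0
  have hK : (a ^ 2)⁻¹ - (b ^ 2)⁻¹ = (b - a) * (a + b) / (a ^ 2 * b ^ 2) := by
    field_simp
    ring
  have hba : ‖b - a‖ = (1 - ρ ^ 2) / ρ := by
    have : b - a = (((ρ ^ 2 - 1) / ρ : ℝ) : ℂ) * ζ := by
      rw [ha, hb]; push_cast; field_simp; ring
    rw [this, norm_mul, hζ, Complex.norm_real, mul_one, Real.norm_eq_abs, abs_div, abs_of_pos h0,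
      abs_of_nonpos (by nlinarith)]
    ring
  have hab : ‖a + b‖ ≤ ‖a‖ * (1 + ρ) / ρ := by
    refine (norm_add_le _ _).trans (le_of_eq ?_)
    rw [hbn]
    field_simp
    ring
  have hwz : ‖w - ζ‖ ≤ 2 * ‖a‖ := by
    have h2 : w - ζ = a - ((1 - ρ : ℝ) : ℂ) * ζ := by rw [ha]; push_cast; ring
    have h3 := norm_sub_le a (((1 - ρ : ℝ) : ℂ) * ζ)
    rw [norm_mul, hζ, Complex.norm_real, mul_one, Real.norm_of_nonneg (by linarith)] at h3
    rw [h2]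
    linarith
  rw [hK, norm_div, norm_mul, norm_mul, norm_pow, norm_pow, hba, hbn]
  have hρ2 : 0 ≤ 1 - ρ ^ 2 := by nlinarith
  calc (1 - ρ ^ 2) / ρ * ‖a + b‖ / (‖a‖ ^ 2 * (‖a‖ / ρ) ^ 2) * ‖w - ζ‖
      ≤ (1 - ρ ^ 2) / ρ * (‖a‖ * (1 + ρ) / ρ) / (‖a‖ ^ 2 * (‖a‖ / ρ) ^ 2) * (2 * ‖a‖) := by
        gcongr
    _ = 2 * (1 + ρ) * ((1 - ρ ^ 2) / ‖a‖ ^ 2) := by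
        field_simp
    _ ≤ 4 * ((1 - ρ ^ 2) / ‖a‖ ^ 2) := by
        have : 0 ≤ (1 - ρ ^ 2) / ‖a‖ ^ 2 := by positivity
        nlinarith

lemma circleIntegrable_poissonKernel {z : ℂ} (hz : z ∈ Metric.ball (0 : ℂ) 1) :
    CircleIntegrable (fun w => (1 - ‖z‖ ^ 2) / ‖w - z‖ ^ 2) 0 1 := by
  apply ContinuousOn.circleIntegrable zero_le_one
  refine ContinuousOn.div continuousOn_const
    (((continuous_id.sub continuous_const).norm.pow 2).continuousOn) ?_
  intro w hw hc
  have hw1 : ‖w‖ = 1 := by simpa using hw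
  have hz1 : ‖z‖ < 1 := by simpa using hz
  have : w = z := by simpa [sub_eq_zero] using hc
  rw [this] at hw1
  linarith

lemma circleAverage_poissonKernel {z : ℂ} (hz : z ∈ Metric.ball (0 : ℂ) 1) :
    Real.circleAverage (fun w => (1 - ‖z‖ ^ 2) / ‖w - z‖ ^ 2) 0 1 = 1 := by
  have h := (diffContOnCl_const (c := (1 : ℂ)) (𝕜 := ℂ)).circleAverage_poissonKernel_smul' hz
  have h1 : Real.circleAverage (fun w => ((1 - ‖z‖ ^ 2) / ‖w - z‖ ^ 2) • (1 : ℂ)) 0 1 = 1 := by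
    refine Eq.trans ?_ h
    apply Real.circleAverage_congr_sphere
    intro w hw
    have hw1 : ‖w‖ = 1 := by simpa using hw
    simp [hw1]
  have h2 := Complex.ofRealCLM.circleAverage_comp_comm (circleIntegrable_poissonKernel hz)
  have h3 : (Complex.ofRealCLM ∘ fun w => (1 - ‖z‖ ^ 2) / ‖w - z‖ ^ 2)
      = fun w => ((1 - ‖z‖ ^ 2) / ‖w - z‖ ^ 2) • (1 : ℂ) := by
    funext w
    simp
  rw [h3, h1, Complex.ofRealCLM_apply] at h2
  exact_mod_cast h2.symm

omit [NormedSpace ℂ E] [CompleteSpace E] in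
lemma norm_circleAverage_le [NormedSpace ℝ E] {f : ℂ → E} {b : ℂ → ℝ}
    (hb : CircleIntegrable b 0 1) (h : ∀ w ∈ Metric.sphere (0 : ℂ) 1, ‖f w‖ ≤ b w) :
    ‖Real.circleAverage f 0 1‖ ≤ Real.circleAverage b 0 1 := by
  unfold Real.circleAverage
  rw [norm_smul, Real.norm_of_nonneg (inv_nonneg.2 Real.two_pi_pos.le), smul_eq_mul]
  refine mul_le_mul_of_nonneg_left ?_ (inv_nonneg.2 Real.two_pi_pos.le)
  refine intervalIntegral.norm_integral_le_of_norm_le Real.two_pi_pos.le ?_ hb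
  exact Eventually.of_forall fun t _ => h _ (by simp)

/-- If `g` is Lipschitz and has the derivative `c` along the unit circle at `ζ`, then `g'` has the
radial limit `c` at `ζ`. -/
lemma tendsto_deriv_of_isLittleO {g : ℂ → E} (hg : DiffContOnCl ℂ g (Metric.ball 0 1)) {K : NNReal}
    (hK : LipschitzWith K g) {ζ : ℂ} (hζ : ‖ζ‖ = 1) {c : E}
    (ho : (fun w => g w - g ζ - (w - ζ) • c) =o[𝓝[Metric.sphere 0 1] ζ] fun w => w - ζ) :
    Tendsto (fun ρ : ℝ => deriv g (ρ * ζ)) (𝓝[<] 1) (𝓝 c) := by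
  set u : ℂ → E := fun w => g w - g ζ - (w - ζ) • c with hu_def
  have hu : DiffContOnCl ℂ u (Metric.ball 0 1) := by
    refine DiffContOnCl.sub (hg.sub_const _) ?_
    apply Differentiable.diffContOnCl
    fun_prop
  set B : ℝ := K + ‖c‖ with hB
  have hB0 : 0 ≤ B := by positivity
  have huB : ∀ w, ‖u w‖ ≤ B * ‖w - ζ‖ := by
    intro w
    refine (norm_sub_le _ _).trans ?_
    have := hK.norm_sub_le w ζ
    rw [norm_smul, hB]
    linarith
  rw [Metric.tendsto_nhds]
  intro ε hε
  -- the kernel bound costs a factor `4`, so `ε / 8` leaves the Poisson average at `ε / 2`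
  have ho' := (Asymptotics.isLittleO_iff.1 ho) (c := ε / 8) (by positivity)
  rw [eventually_nhdsWithin_iff, Metric.eventually_nhds_iff] at ho'
  obtain ⟨δ, hδ, ho'⟩ := ho'
  have hlim : Tendsto (fun ρ : ℝ => ε / 2 + 16 * B * (1 - ρ ^ 2) / δ ^ 2) (𝓝[<] 1) (𝓝 (ε / 2)) := by
    have : Continuous fun ρ : ℝ => ε / 2 + 16 * B * (1 - ρ ^ 2) / δ ^ 2 := by fun_prop
    have h := this.tendsto 1
    norm_num at h
    exact h.mono_left nhdsWithin_le_nhds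
  have hpos : ∀ᶠ ρ : ℝ in 𝓝[<] 1, 0 < ρ :=
    nhdsWithin_le_nhds (Ioi_mem_nhds zero_lt_one)
  filter_upwards [hlim.eventually (gt_mem_nhds (half_lt_self hε)), hpos, self_mem_nhdsWithin]
    with ρ hρ h0 h1
  replace h1 : ρ < 1 := h1
  refine lt_of_le_of_lt ?_ hρ
  set z : ℂ := ρ * ζ with hz_def
  have hnz : ‖z‖ = ρ := by
    rw [hz_def, norm_mul, hζ, Complex.norm_real, Real.norm_of_nonneg h0.le, mul_one]
  have hz : z ∈ Metric.ball (0 : ℂ) 1 := by simpa [hnz] using h1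
  have hz' : 1 < ‖((ρ⁻¹ : ℝ) : ℂ) * ζ‖ := by
    rw [norm_mul, hζ, Complex.norm_real, Real.norm_of_nonneg (inv_nonneg.2 h0.le), mul_one]
    exact (one_lt_inv₀ h0).2 h1
  have hdu : deriv u z = deriv g z - c := by
    have hgz : HasDerivAt g (deriv g z) z :=
      (hg.differentiableAt Metric.isOpen_ball hz).hasDerivAt
    have h2 : HasDerivAt (fun w : ℂ => (w - ζ) • c) c z := by
      simpa using ((hasDerivAt_id z).sub_const ζ).smul_const c
    exact ((hgz.sub_const _).sub h2).deriv
  rw [dist_eq_norm, ← hdu]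
  have hint := two_pi_I_smul_deriv_eq_circleIntegral hu hz hz'
  set k : ℂ → ℂ := fun w => ((w - z) ^ 2)⁻¹ - ((w - ((ρ⁻¹ : ℝ) : ℂ) * ζ) ^ 2)⁻¹ with hk
  have havg : deriv u z = Real.circleAverage (fun w => w • k w • u w) 0 1 := by
    rw [Real.circleAverage_eq_circleIntegral one_ne_zero]
    have : (∮ w in C(0, 1), (w - 0)⁻¹ • w • k w • u w) = ∮ w in C(0, 1), k w • u w := by
      apply circleIntegral.integral_congr zero_le_one
      intro w hw
      have hw0 : w ≠ 0 := by
        rintro rfl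
        simp at hw
      simp only [sub_zero]
      rw [smul_smul, inv_mul_cancel₀ hw0, one_smul]
    rw [this, hint, smul_smul, inv_mul_cancel₀ Complex.two_pi_I_ne_zero, one_smul]
  rw [havg]
  have hP := circleIntegrable_poissonKernel hz
  have hCI : CircleIntegrable (fun _ : ℂ => 16 * B * (1 - ρ ^ 2) / δ ^ 2) 0 1 :=
    continuousOn_const.circleIntegrable zero_le_one
  have hPI : CircleIntegrable ((ε / 2) • fun w => (1 - ‖z‖ ^ 2) / ‖w - z‖ ^ 2) 0 1 :=
    hP.const_smul
  have hb : Real.circleAverage (((ε / 2) • fun w => (1 - ‖z‖ ^ 2) / ‖w - z‖ ^ 2)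
      + fun _ => 16 * B * (1 - ρ ^ 2) / δ ^ 2) 0 1 = ε / 2 + 16 * B * (1 - ρ ^ 2) / δ ^ 2 := by
    rw [Real.circleAverage_add hPI hCI, Real.circleAverage_smul, circleAverage_poissonKernel hz,
      Real.circleAverage_const, smul_eq_mul, mul_one]
  rw [← hb]
  refine norm_circleAverage_le (hPI.add hCI) ?_
  intro w hw
  have hw1 : ‖w‖ = 1 := by simpa using hw
  have hker := norm_reflectedKernel_mul_le h0 h1 hζ hw1
  rw [norm_smul, hw1, one_mul, norm_smul]
  simp only [Pi.add_apply, Pi.smul_apply, smul_eq_mul]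
  rw [hnz]
  have hρ2 : 0 ≤ 1 - ρ ^ 2 := by nlinarith
  have hC0 : 0 ≤ 16 * B * (1 - ρ ^ 2) / δ ^ 2 := by positivity
  have hP0 : 0 ≤ (1 - ρ ^ 2) / ‖w - z‖ ^ 2 := by positivity
  -- near `ζ` the Poisson kernel absorbs `u`; away from `ζ` the kernel itself is `O(1 - ρ²)`
  by_cases hwδ : dist w ζ < δ
  · have h2 : ‖u w‖ ≤ ε / 8 * ‖w - ζ‖ := ho' hwδ hw
    have h3 : ‖k w‖ * ‖u w‖ ≤ ‖k w‖ * (ε / 8 * ‖w - ζ‖) := by gcongr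
    have h4 : ε / 8 * (‖k w‖ * ‖w - ζ‖) ≤ ε / 8 * (4 * ((1 - ρ ^ 2) / ‖w - z‖ ^ 2)) := by gcongr
    linarith
  · have h2 : δ ≤ ‖w - ζ‖ := by rw [← dist_eq_norm]; exact not_lt.1 hwδ
    have hz2 : ‖w - ζ‖ ≤ 2 * ‖w - z‖ := by
      have e1 := norm_sub_le_norm_sub_add_norm_sub w z ζ
      have e2 : ‖z - ζ‖ = 1 - ρ := by
        have : z - ζ = ((ρ - 1 : ℝ) : ℂ) * ζ := by rw [hz_def]; push_cast; ring
        rw [this, norm_mul, hζ, Complex.norm_real, mul_one, Real.norm_eq_abs,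
          abs_of_nonpos (by linarith)]
        ring
      have e3 := norm_sub_norm_le w z
      rw [hw1, hnz] at e3
      linarith
    have h3 : ‖k w‖ * ‖u w‖ ≤ ‖k w‖ * (B * ‖w - ζ‖) := by gcongr; exact huB w
    have h4 : B * (‖k w‖ * ‖w - ζ‖) ≤ B * (4 * ((1 - ρ ^ 2) / ‖w - z‖ ^ 2)) := by gcongr
    have h5 : (1 - ρ ^ 2) / ‖w - z‖ ^ 2 ≤ (1 - ρ ^ 2) / (δ / 2) ^ 2 := by
      gcongr
      linarith
    have h6 : B * (4 * ((1 - ρ ^ 2) / (δ / 2) ^ 2)) = 16 * B * (1 - ρ ^ 2) / δ ^ 2 := by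
      field_simp
      ring
    have h7 : B * (4 * ((1 - ρ ^ 2) / ‖w - z‖ ^ 2)) ≤ B * (4 * ((1 - ρ ^ 2) / (δ / 2) ^ 2)) := by
      gcongr
    have h8 : 0 ≤ ε / 2 * ((1 - ρ ^ 2) / ‖w - z‖ ^ 2) := by positivity
    linarith

omit [CompleteSpace E] in
/-- Differentiability of `t ↦ g (e^{it})` in terms of the variable on the circle: the derivative
along the circle exists. -/
lemma exists_isLittleO_of_differentiableAt_circleMap {g : ℂ → E} {t : ℝ}
    (h : DifferentiableAt ℝ (fun s => g (circleMap 0 1 s)) t) :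
    ∃ c : E, (fun w => g w - g (circleMap 0 1 t) - (w - circleMap 0 1 t) • c)
      =o[𝓝[Metric.sphere 0 1] (circleMap 0 1 t)] fun w => w - circleMap 0 1 t := by
  set ζ := circleMap 0 1 t with hζ
  have hζ1 : ‖ζ‖ = 1 := by simp [hζ]
  have hζ0 : ζ ≠ 0 := by intro h; simp [h] at hζ1
  set d := deriv (fun s => g (circleMap 0 1 s)) t with hd
  have h1 : (fun s => g (circleMap 0 1 s) - g ζ - (s - t) • d) =o[𝓝 t] fun s => s - t :=
    hasDerivAt_iff_isLittleO.1 h.hasDerivAt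
  have h2 : (fun s => circleMap 0 1 s - ζ - (s - t) • (ζ * Complex.I)) =o[𝓝 t] fun s => s - t :=
    hasDerivAt_iff_isLittleO.1 (hasDerivAt_circleMap 0 1 t)
  set c : E := (ζ * Complex.I)⁻¹ • d with hc
  refine ⟨c, ?_⟩
  have h3 : (fun s => g (circleMap 0 1 s) - g ζ - (circleMap 0 1 s - ζ) • c) =o[𝓝 t]
      fun s => s - t := by
    have h4 : (fun s => (circleMap 0 1 s - ζ - (s - t) • (ζ * Complex.I)) • c) =o[𝓝 t]
        fun s => s - t := by
      refine Asymptotics.IsBigO.trans_isLittleO ?_ h2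
      refine Asymptotics.IsBigO.of_bound ‖c‖ (Eventually.of_forall fun s => ?_)
      rw [norm_smul, mul_comm]
    refine (h1.sub h4).congr_left fun s => ?_
    have : ((s - t) • (ζ * Complex.I)) • c = (s - t) • d := by
      rw [hc, smul_assoc, smul_smul, mul_inv_cancel₀ (mul_ne_zero hζ0 Complex.I_ne_zero), one_smul]
    rw [sub_smul (circleMap 0 1 s - ζ), this]
    abel
  -- the angle as a function of the point on the circle
  set φ : ℂ → ℝ := fun w => t + (Complex.log (w / ζ)).im with hφ
  have hlog : HasDerivAt (fun w => Complex.log (w / ζ)) (1 / ζ) ζ := by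
    have := ((hasDerivAt_id ζ).div_const ζ).clog (by simp [hζ0])
    simpa [hζ0] using this
  have hφt : Tendsto φ (𝓝 ζ) (𝓝 t) := by
    have : ContinuousAt φ ζ :=
      continuousAt_const.add (Complex.continuous_im.continuousAt.comp hlog.continuousAt)
    have h5 := this.tendsto
    simpa [hφ, hζ0] using h5
  have hφO : (fun w => φ w - t) =O[𝓝 ζ] fun w => w - ζ := by
    have h5 := hlog.differentiableAt.isBigO_sub
    refine Asymptotics.IsBigO.trans (Asymptotics.IsBigO.of_bound 1
      (Eventually.of_forall fun w => ?_)) h5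
    simp only [hφ, add_sub_cancel_left, one_mul, div_self hζ0, Complex.log_one, sub_zero]
    exact Complex.abs_im_le_norm _
  have h6 := (h3.comp_tendsto hφt).trans_isBigO hφO
  refine (h6.mono nhdsWithin_le_nhds).congr' ?_ EventuallyEq.rfl
  filter_upwards [self_mem_nhdsWithin] with w hw
  have hw1 : ‖w‖ = 1 := by simpa using hw
  have hw0 : w ≠ 0 := by intro h; simp [h] at hw1
  have hkey : circleMap 0 1 (φ w) = w := by
    have h7 : Complex.log (w / ζ) = (Complex.log (w / ζ)).im * Complex.I := by
      apply Complex.ext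
      · simp [Complex.log_re, hw1, hζ1]
      · simp
    rw [circleMap_zero, hφ]
    push_cast
    rw [add_mul, Complex.exp_add, ← h7, Complex.exp_log (div_ne_zero hw0 hζ0)]
    rw [hζ, circleMap_zero]
    have : Complex.exp (t * Complex.I) ≠ 0 := Complex.exp_ne_zero _
    push_cast
    field_simp
  simp only [Function.comp_apply, hkey]

end Fatou

/-- **Fatou's theorem** for bounded analytic functions: radial limits exist almost everywhere. A
primitive is Lipschitz, so it is differentiable along almost every point of the circle. -/
theorem ae_exists_tendsto_radial {E : Type*} [NormedAddCommGroup E] [NormedSpace ℂ E]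
    [FiniteDimensional ℂ E] {f : ℂ → E} (hf : DifferentiableOn ℂ f (Metric.ball 0 1)) {C : ℝ}
    (hC : ∀ z ∈ Metric.ball (0 : ℂ) 1, ‖f z‖ ≤ C) :
    ∀ᵐ t : ℝ, ∃ L, Tendsto (fun ρ : ℝ => f (circleMap 0 ρ t)) (𝓝[<] 1) (𝓝 L) := by
  have : CompleteSpace E := FiniteDimensional.complete ℂ E
  have : FiniteDimensional ℝ E := FiniteDimensional.complexToReal E
  obtain ⟨g₀, hg₀⟩ := hf.isExactOn_ball
  have hC0 : 0 ≤ C := (norm_nonneg _).trans (hC 0 (by simp))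
  have hlip : LipschitzOnWith ⟨C, hC0⟩ g₀ (Metric.ball 0 1) :=
    (convex_ball 0 1).lipschitzOnWith_of_nnnorm_hasDerivWithin_le
      (fun z hz => (hg₀ z hz).hasDerivWithinAt) fun z hz => hC z hz
  obtain ⟨g, hg, hgg⟩ := hlip.extend_finite_dimension
  have hgd : ∀ z ∈ Metric.ball (0 : ℂ) 1, HasDerivAt g (f z) z := fun z hz =>
    (hg₀ z hz).congr_of_eventuallyEq
      (eventually_of_mem (Metric.isOpen_ball.mem_nhds hz) fun w hw => (hgg hw).symm)
  have hgc : DiffContOnCl ℂ g (Metric.ball 0 1) :=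
    ⟨fun z hz => (hgd z hz).differentiableAt.differentiableWithinAt, hg.continuous.continuousOn⟩
  have hG := (hg.comp (lipschitzWith_circleMap 0 1)).lipschitzOnWith (s := univ)
  filter_upwards [hG.ae_differentiableWithinAt_of_mem_real] with t ht
  have hdt : DifferentiableAt ℝ (fun s => g (circleMap 0 1 s)) t :=
    differentiableWithinAt_univ.1 (ht (mem_univ t))
  obtain ⟨c, hc⟩ := exists_isLittleO_of_differentiableAt_circleMap hdt
  refine ⟨c, ?_⟩
  have hlim := tendsto_deriv_of_isLittleO hgc hg (by simp) hc
  refine hlim.congr' ?_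
  have hpos : ∀ᶠ ρ : ℝ in 𝓝[<] 1, 0 < ρ := nhdsWithin_le_nhds (Ioi_mem_nhds zero_lt_one)
  filter_upwards [hpos, self_mem_nhdsWithin] with ρ h0 h1
  have hmem : circleMap 0 ρ t ∈ Metric.ball (0 : ℂ) 1 := by
    simpa [abs_of_pos h0] using h1
  have : (ρ : ℂ) * circleMap 0 1 t = circleMap 0 ρ t := by simp [circleMap_zero]
  rw [this, (hgd _ hmem).deriv]

/-! ### Taylor coefficients and Parseval's identity -/

section Parseval

variable {E : Type*} [NormedAddCommGroup E] [InnerProductSpace ℂ E]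

lemma circleAverage_conj_pow_mul_pow {ρ : ℝ} (h0 : 0 < ρ) (n k : ℕ) :
    Real.circleAverage (fun z => (starRingEnd ℂ) z ^ n * z ^ k) 0 ρ
      = if k = n then (ρ : ℂ) ^ (2 * n) else 0 := by
  have hρ : (ρ : ℂ) ≠ 0 := by exact_mod_cast h0.ne'
  rw [Real.circleAverage_eq_circleIntegral h0.ne']
  have h1 : (∮ z in C(0, ρ), (z - 0)⁻¹ • ((starRingEnd ℂ) z ^ n * z ^ k))
      = ∮ z in C(0, ρ), (ρ : ℂ) ^ (2 * n) * (z - 0) ^ ((k : ℤ) - n - 1) := by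
    apply circleIntegral.integral_congr h0.le
    intro z hz
    have hz1 : ‖z‖ = ρ := by simpa using hz
    have hz0 : z ≠ 0 := by intro h; rw [h, norm_zero] at hz1; exact h0.ne hz1
    have hc : (starRingEnd ℂ) z = (ρ : ℂ) ^ 2 * z⁻¹ := by
      rw [Complex.inv_def, Complex.normSq_eq_norm_sq, hz1]
      push_cast
      field_simp
    simp only [sub_zero, smul_eq_mul]
    rw [hc, mul_pow, ← pow_mul, sub_sub, zpow_sub₀ hz0, zpow_natCast, zpow_add₀ hz0, zpow_natCast,
      zpow_one]
    field_simp
    rw [one_div, inv_pow, inv_mul_cancel₀ (pow_ne_zero n hz0)]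
  rw [h1, circleIntegral.integral_const_mul]
  split_ifs with h
  · subst h
    have h2 : (∮ z in C(0, ρ), (z - 0) ^ ((k : ℤ) - k - 1)) = ∮ z in C(0, ρ), (z - 0)⁻¹ := by
      congr 1
      funext z
      rw [sub_self, zero_sub, zpow_neg_one]
    rw [h2, circleIntegral.integral_sub_center_inv 0 h0.ne', smul_eq_mul]
    have := Complex.two_pi_I_ne_zero
    field_simp
  · rw [circleIntegral.integral_sub_zpow_of_ne (by omega)]
    simp

lemma hasSum_circleAverage {V : Type*} [NormedAddCommGroup V] [NormedSpace ℝ V] [CompleteSpace V]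
    {ρ : ℝ} (h0 : 0 ≤ ρ) {f : ℕ → ℂ → V} {g : ℂ → V} {b : ℕ → ℝ}
    (hf : ∀ n, ContinuousOn (f n) (Metric.sphere 0 ρ))
    (hb : ∀ n, ∀ z ∈ Metric.sphere (0 : ℂ) ρ, ‖f n z‖ ≤ b n) (hs : Summable b)
    (hg : ∀ z ∈ Metric.sphere (0 : ℂ) ρ, HasSum (fun n => f n z) (g z)) :
    HasSum (fun n => Real.circleAverage (f n) 0 ρ) (Real.circleAverage g 0 ρ) := by
  unfold Real.circleAverage
  apply HasSum.const_smul
  have hmem : ∀ t : ℝ, circleMap 0 ρ t ∈ Metric.sphere (0 : ℂ) ρ := fun t =>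
    circleMap_mem_sphere 0 h0 t
  apply intervalIntegral.hasSum_integral_of_dominated_convergence (fun n _ => b n)
  · intro n
    have : Continuous fun t => f n (circleMap 0 ρ t) :=
      (hf n).comp_continuous (continuous_circleMap 0 ρ) hmem
    exact this.aestronglyMeasurable
  · exact fun n => Eventually.of_forall fun t _ => hb n _ (hmem t)
  · exact Eventually.of_forall fun _ _ => hs
  · exact intervalIntegrable_const
  · exact Eventually.of_forall fun t _ => hg _ (hmem t)

omit [InnerProductSpace ℂ E] in
lemma summable_pow_mul_norm [NormedSpace ℂ E] {a : ℕ → E}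
    (ha : ∀ z ∈ Metric.ball (0 : ℂ) 1, Summable fun n => z ^ n • a n) {ρ : ℝ} (h0 : 0 ≤ ρ)
    (h1 : ρ < 1) : Summable fun n => ρ ^ n * ‖a n‖ := by
  obtain ⟨R, hR, hR1⟩ := exists_between h1
  have hR0 : 0 < R := h0.trans_lt hR
  have ht := (ha (R : ℂ) (by simpa [abs_of_pos hR0] using hR1)).tendsto_atTop_zero.norm
  obtain ⟨M, hM⟩ := ht.bddAbove_range
  refine Summable.of_nonneg_of_le (fun n => by positivity) (fun n => ?_)
    ((summable_geometric_of_lt_one (by positivity) ((div_lt_one hR0).2 hR)).mul_left M)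
  have h2 : ‖(R : ℂ) ^ n • a n‖ ≤ M := hM ⟨n, rfl⟩
  rw [norm_smul, norm_pow, Complex.norm_real, Real.norm_of_nonneg hR0.le] at h2
  calc ρ ^ n * ‖a n‖ = (R ^ n * ‖a n‖) * (ρ / R) ^ n := by rw [div_pow]; field_simp
    _ ≤ M * (ρ / R) ^ n := by gcongr

/-- **Parseval's identity** on the circle of radius `ρ`. -/
lemma hasSum_meanSq [CompleteSpace E] {a : ℕ → E} {F : ℂ → E}
    (hF : ∀ z ∈ Metric.ball (0 : ℂ) 1, HasSum (fun n => z ^ n • a n) (F z)) {ρ : ℝ}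
    (hρ : ρ ∈ Ioo (0 : ℝ) 1) : HasSum (fun n => (ρ ^ n) ^ 2 * ‖a n‖ ^ 2) (meanSq F ρ) := by
  obtain ⟨h0, h1⟩ := hρ
  have hmem : ∀ z ∈ Metric.sphere (0 : ℂ) ρ, z ∈ Metric.ball (0 : ℂ) 1 := by
    intro z hz
    have : ‖z‖ = ρ := by simpa using hz
    simpa [this] using h1
  have hsum := summable_pow_mul_norm (fun z hz => (hF z hz).summable) h0.le h1
  have hnz : ∀ n, ∀ z ∈ Metric.sphere (0 : ℂ) ρ, ‖z ^ n • a n‖ ≤ ρ ^ n * ‖a n‖ := by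
    intro n z hz
    have : ‖z‖ = ρ := by simpa using hz
    rw [norm_smul, norm_pow, this]
  have hbd : ∀ z ∈ Metric.sphere (0 : ℂ) ρ, ‖F z‖ ≤ ∑' n, ρ ^ n * ‖a n‖ := by
    intro z hz
    rw [← (hF z (hmem z hz)).tsum_eq]
    exact tsum_of_norm_bounded hsum.hasSum fun n => hnz n z hz
  have hFc : ContinuousOn F (Metric.sphere 0 ρ) := by
    have : ContinuousOn (fun z => ∑' n, z ^ n • a n) (Metric.sphere (0 : ℂ) ρ) :=
      continuousOn_tsum (fun n => by fun_prop) hsum hnz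
    exact this.congr fun z hz => ((hF z (hmem z hz)).tsum_eq).symm
  have hcoef : ∀ n, Real.circleAverage (fun z => (starRingEnd ℂ) z ^ n • F z) 0 ρ
      = (ρ : ℂ) ^ (2 * n) • a n := by
    intro n
    have h2 := hasSum_circleAverage h0.le (f := fun k z => ((starRingEnd ℂ) z ^ n * z ^ k) • a k)
      (g := fun z => (starRingEnd ℂ) z ^ n • F z) (b := fun k => ρ ^ n * (ρ ^ k * ‖a k‖))
      (fun k => (((Complex.continuous_conj.pow n).mul (continuous_pow k)).smul
        continuous_const).continuousOn)
      (fun k z hz => by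
        have : ‖z‖ = ρ := by simpa using hz
        rw [norm_smul, norm_mul, norm_pow, norm_pow, RCLike.norm_conj, this, mul_assoc])
      (hsum.mul_left _)
      (fun z hz => by
        simp only [mul_smul]
        exact (hF z (hmem z hz)).const_smul _)
    refine h2.unique ?_
    convert! hasSum_ite_eq n ((ρ : ℂ) ^ (2 * n) • a n) using 2 with k
    have h3 := circleAverage_conj_pow_mul_pow h0 n k
    unfold Real.circleAverage at h3 ⊢
    rw [intervalIntegral.integral_smul_const, ← smul_assoc, h3]
    split_ifs with h
    · rw [h]
    · rw [zero_smul]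
  have h4 := hasSum_circleAverage h0.le
    (f := fun n z => (inner ℂ (a n) ((starRingEnd ℂ) z ^ n • F z)).re)
    (g := fun z => ‖F z‖ ^ 2) (b := fun n => (ρ ^ n * ‖a n‖) * ∑' n, ρ ^ n * ‖a n‖)
    (fun n => Complex.continuous_re.comp_continuousOn
      (continuousOn_const.inner (((Complex.continuous_conj.pow n).continuousOn).smul hFc)))
    (fun n z hz => by
      have h5 : ‖z‖ = ρ := by simpa using hz
      refine (Complex.abs_re_le_norm _).trans ((norm_inner_le_norm _ _).trans ?_)
      rw [norm_smul, norm_pow, RCLike.norm_conj, h5]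
      have := hbd z hz
      calc ‖a n‖ * (ρ ^ n * ‖F z‖) = ρ ^ n * ‖a n‖ * ‖F z‖ := by ring
        _ ≤ _ := by gcongr)
    (hsum.mul_right _)
    (fun z hz => by
      have h5 := ((innerSL ℂ).flip (F z)).hasSum (hF z (hmem z hz))
      have h6 := Complex.reCLM.hasSum h5
      convert! h6 using 1
      · funext n
        simp
      · have := inner_self_eq_norm_sq (𝕜 := ℂ) (F z)
        simpa using this.symm)
  convert! h4 using 1
  funext n
  have hci : CircleIntegrable (fun z => (starRingEnd ℂ) z ^ n • F z) 0 ρ :=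
    ContinuousOn.circleIntegrable h0.le (((Complex.continuous_conj.pow n).continuousOn).smul hFc)
  have h7 := (Complex.reCLM ∘L ((innerSL ℂ (a n)).restrictScalars ℝ)).circleAverage_comp_comm hci
  rw [hcoef n] at h7
  have h8 : (fun z => (inner ℂ (a n) ((starRingEnd ℂ) z ^ n • F z)).re)
      = (Complex.reCLM ∘L ((innerSL ℂ (a n)).restrictScalars ℝ))
        ∘ fun z => (starRingEnd ℂ) z ^ n • F z := by
    funext z
    simp
  rw [h8, h7]
  have h9 : inner ℂ (a n) (a n) = ((‖a n‖ ^ 2 : ℝ) : ℂ) := by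
    rw [inner_self_eq_norm_sq_to_K]
    norm_cast
  simp only [ContinuousLinearMap.comp_apply, ContinuousLinearMap.coe_restrictScalars',
    innerSL_apply_apply, inner_smul_right, h9, Complex.reCLM_apply]
  rw [← Complex.ofReal_pow, ← Complex.ofReal_mul, Complex.ofReal_re, ← pow_mul, mul_comm n 2]

/-- Taylor coefficients are unique. -/
lemma eq_of_hasSum_pow_smul [CompleteSpace E] {a b : ℕ → E} {F : ℂ → E}
    (ha : ∀ z ∈ Metric.ball (0 : ℂ) 1, HasSum (fun n => z ^ n • a n) (F z))
    (hb : ∀ z ∈ Metric.ball (0 : ℂ) 1, HasSum (fun n => z ^ n • b n) (F z)) : a = b := by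
  have h : ∀ z ∈ Metric.ball (0 : ℂ) 1, HasSum (fun n => z ^ n • (a n - b n)) ((0 : ℂ → E) z) := by
    intro z hz
    simpa [smul_sub] using (ha z hz).sub (hb z hz)
  have h2 := hasSum_meanSq h (ρ := 1 / 2) ⟨by norm_num, by norm_num⟩
  have h3 : meanSq (0 : ℂ → E) (1 / 2) = 0 := by simp [meanSq, Real.circleAverage]
  rw [h3, hasSum_zero_iff_of_nonneg fun n => by positivity] at h2
  funext n
  have h4 := congrFun h2 n
  simpa [sub_eq_zero] using h4

namespace H2

variable [CompleteSpace E]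

/-- The `n`-th Taylor coefficient at the origin. -/
def coeff (F : H2 E) (n : ℕ) : E := (n.factorial : ℂ)⁻¹ • iteratedDeriv n F 0

lemma hasSum_coeff (F : H2 E) {z : ℂ} (hz : z ∈ Metric.ball (0 : ℂ) 1) :
    HasSum (fun n => z ^ n • coeff F n) (F z) := by
  have h := Complex.hasSum_taylorSeries_on_ball F.differentiableOn hz
  simp only [sub_zero] at h
  convert! h using 2 with n
  rw [coeff, smul_comm]

lemma coeff_eq {F : H2 E} {a : ℕ → E}
    (h : ∀ z ∈ Metric.ball (0 : ℂ) 1, HasSum (fun n => z ^ n • a n) (F z)) : coeff F = a :=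
  eq_of_hasSum_pow_smul (fun _ hz => F.hasSum_coeff hz) h

lemma coeff_add (F G : H2 E) : coeff (F + G) = coeff F + coeff G :=
  coeff_eq fun z hz => by
    simpa [smul_add] using (F.hasSum_coeff hz).add (G.hasSum_coeff hz)

lemma coeff_smul (c : ℂ) (F : H2 E) : coeff (c • F) = c • coeff F :=
  coeff_eq fun z hz => by
    convert! (F.hasSum_coeff hz).const_smul c using 2 with n
    exact smul_comm _ _ _

lemma sum_norm_coeff_sq_le (F : H2 E) (s : Finset ℕ) : ∑ n ∈ s, ‖coeff F n‖ ^ 2 ≤ ‖F‖ ^ 2 := by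
  have hc : Continuous fun ρ : ℝ => ∑ n ∈ s, (ρ ^ n) ^ 2 * ‖coeff F n‖ ^ 2 := by fun_prop
  have h1 := (hc.tendsto 1).mono_left (nhdsWithin_le_nhds (s := Iio 1))
  simp only [one_pow, one_mul] at h1
  refine le_of_tendsto h1 ?_
  have hpos : ∀ᶠ ρ : ℝ in 𝓝[<] 1, 0 < ρ := nhdsWithin_le_nhds (Ioi_mem_nhds zero_lt_one)
  filter_upwards [hpos, self_mem_nhdsWithin] with ρ h0 h1
  have h2 := hasSum_meanSq (fun z hz => F.hasSum_coeff hz) ⟨h0, h1⟩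
  exact (sum_le_hasSum s (fun n _ => by positivity) h2).trans (meanSq_le_norm_sq F ⟨h0, h1⟩)

lemma summable_norm_coeff_sq (F : H2 E) : Summable fun n => ‖coeff F n‖ ^ 2 :=
  summable_of_sum_le (fun n => by positivity) F.sum_norm_coeff_sq_le

lemma meanSq_le_tsum {a : ℕ → E} {F : ℂ → E}
    (hF : ∀ z ∈ Metric.ball (0 : ℂ) 1, HasSum (fun n => z ^ n • a n) (F z))
    (ha : Summable fun n => ‖a n‖ ^ 2) {ρ : ℝ} (hρ : ρ ∈ Ioo (0 : ℝ) 1) :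
    meanSq F ρ ≤ ∑' n, ‖a n‖ ^ 2 := by
  have h2 := hasSum_meanSq hF hρ
  refine hasSum_le (fun n => ?_) h2 ha.hasSum
  have h3 : (ρ ^ n) ^ 2 ≤ 1 := by
    rw [← pow_mul]
    exact pow_le_one₀ hρ.1.le hρ.2.le
  nlinarith [sq_nonneg ‖a n‖]

lemma norm_sq_eq_tsum (F : H2 E) : ‖F‖ ^ 2 = ∑' n, ‖coeff F n‖ ^ 2 := by
  apply le_antisymm
  · exact norm_sq_le fun ρ hρ =>
      meanSq_le_tsum (fun z hz => F.hasSum_coeff hz) F.summable_norm_coeff_sq hρ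
  · exact F.summable_norm_coeff_sq.tsum_le_of_sum_le F.sum_norm_coeff_sq_le

/-- The element of `H²` with prescribed square summable Taylor coefficients. -/
def ofCoeff (a : ℕ → E) (ha : Summable fun n => ‖a n‖ ^ 2) : H2 E :=
  ⟨(Metric.ball (0 : ℂ) 1).indicator fun z => ∑' n, z ^ n • a n, by
    have hsum : ∀ R : ℝ, 0 ≤ R → R < 1 → Summable fun n => R ^ n * ‖a n‖ := by
      intro R h0 h1
      have hb : ∀ n, R ^ n * ‖a n‖ ≤ (R ^ 2) ^ n + ‖a n‖ ^ 2 := by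
        intro n
        rw [← pow_mul, mul_comm 2 n, pow_mul]
        nlinarith [sq_nonneg (R ^ n - ‖a n‖), sq_nonneg (R ^ n), sq_nonneg ‖a n‖]
      exact Summable.of_nonneg_of_le (fun n => by positivity) hb
        ((summable_geometric_of_lt_one (by positivity) (by nlinarith)).add ha)
    have hF : ∀ z ∈ Metric.ball (0 : ℂ) 1, HasSum (fun n => z ^ n • a n)
        ((Metric.ball (0 : ℂ) 1).indicator (fun z => ∑' n, z ^ n • a n) z) := by
      intro z hz
      rw [indicator_of_mem hz]
      refine (Summable.of_norm ?_).hasSum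
      simpa [norm_smul] using hsum ‖z‖ (norm_nonneg z) (by simpa using hz)
    refine ⟨?_, fun z hz => indicator_of_notMem hz _, ∑' n, ‖a n‖ ^ 2, ?_⟩
    · intro z hz
      obtain ⟨R, hR, hR1⟩ := exists_between (show ‖z‖ < 1 by simpa using hz)
      have hR0 := (norm_nonneg z).trans hR.le
      have hd : DifferentiableOn ℂ (fun z : ℂ => ∑' n, z ^ n • a n) (Metric.ball 0 R) := by
        refine Complex.differentiableOn_tsum_of_summable_norm (hsum R hR0 hR1) (fun n => by fun_prop)
          Metric.isOpen_ball fun n w hw => ?_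
        have : ‖w‖ ≤ R := by simpa using (Metric.mem_ball.1 hw).le
        rw [norm_smul, norm_pow]
        gcongr
      have hzR : Metric.ball (0 : ℂ) R ∈ 𝓝 z := Metric.isOpen_ball.mem_nhds (by simpa using hR)
      refine DifferentiableAt.differentiableWithinAt
        (((hd z (mem_of_mem_nhds hzR)).differentiableAt hzR).congr_of_eventuallyEq ?_)
      filter_upwards [Metric.isOpen_ball.mem_nhds hz] with w hw
      exact indicator_of_mem hw _
    · rintro _ ⟨ρ, rfl⟩
      exact meanSq_le_tsum hF ha ρ.2⟩

lemma coeff_ofCoeff (a : ℕ → E) (ha : Summable fun n => ‖a n‖ ^ 2) : coeff (ofCoeff a ha) = a := by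
  apply coeff_eq
  intro z hz
  have h : ofCoeff a ha z = ∑' n, z ^ n • a n :=
    indicator_of_mem hz (fun z => ∑' n, z ^ n • a n)
  rw [h]
  refine (Summable.of_norm ?_).hasSum
  have hb : ∀ n, ‖z ^ n • a n‖ ≤ (‖z‖ ^ 2) ^ n + ‖a n‖ ^ 2 := by
    intro n
    rw [← pow_mul, mul_comm 2 n, pow_mul, norm_smul, norm_pow]
    nlinarith [sq_nonneg (‖z‖ ^ n - ‖a n‖), sq_nonneg (‖z‖ ^ n), sq_nonneg ‖a n‖]
  have h1 : ‖z‖ < 1 := by simpa using hz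
  exact Summable.of_nonneg_of_le (fun n => by positivity) hb
    ((summable_geometric_of_lt_one (by positivity) (by nlinarith [norm_nonneg z])).add ha)

variable (E) in
/-- Taking Taylor coefficients identifies `H²` with the square summable sequences. -/
def coeffEquiv : H2 E ≃ₗᵢ[ℂ] lp (fun _ : ℕ => E) 2 :=
  LinearIsometryEquiv.ofSurjective
    { toFun := fun F => ⟨coeff F, memℓp_gen (by simpa using F.summable_norm_coeff_sq)⟩
      map_add' := fun F G => by ext n; exact congrFun (coeff_add F G) n
      map_smul' := fun c F => by ext n; exact congrFun (coeff_smul c F) n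
      norm_map' := fun F => by
        refine (sq_eq_sq₀ (norm_nonneg _) (norm_nonneg _)).1 ?_
        have h := lp.norm_rpow_eq_tsum (p := 2) (by norm_num)
          (⟨coeff F, memℓp_gen (by simpa using F.summable_norm_coeff_sq)⟩ : lp (fun _ : ℕ => E) 2)
        simp only [ENNReal.toReal_ofNat, Real.rpow_ofNat] at h
        exact h.trans F.norm_sq_eq_tsum.symm }
    fun a => by
      have ha : Summable fun n => ‖a n‖ ^ 2 := by
        simpa using (lp.memℓp a).summable (by norm_num)
      refine ⟨ofCoeff a ha, ?_⟩
      ext n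
      exact congrFun (coeff_ofCoeff a ha) n

@[simp] lemma coeffEquiv_apply (F : H2 E) (n : ℕ) : coeffEquiv E F n = coeff F n := rfl

instance : CompleteSpace (H2 E) :=
  (coeffEquiv E).toIsometryEquiv.completeSpace

/-- The inner product `⟪F, G⟫ = ∑ ⟪Fₙ, Gₙ⟫` of the sequences of Taylor coefficients; its norm is the
Hardy norm. -/
instance : InnerProductSpace ℂ (H2 E) where
  inner F G := inner ℂ (coeffEquiv E F) (coeffEquiv E G)
  norm_sq_eq_re_inner F := by
    rw [← (coeffEquiv E).norm_map]
    exact norm_sq_eq_re_inner _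
  conj_inner_symm F G := inner_conj_symm _ _
  add_left F G H := by simp only [map_add, inner_add_left]
  smul_left F G c := by simp only [map_smul, inner_smul_left]

lemma ext_coeff {F G : H2 E} (h : coeff F = coeff G) : F = G :=
  (coeffEquiv E).injective (by ext n; exact congrFun h n)

/-- The reproducing kernel bound for point evaluation; the constant is sharp. -/
lemma norm_apply_sq_le (F : H2 E) {z : ℂ} (hz : z ∈ Metric.ball (0 : ℂ) 1) :
    ‖F z‖ ^ 2 ≤ (1 - ‖z‖ ^ 2)⁻¹ * ‖F‖ ^ 2 := by
  have h1 : ‖z‖ < 1 := by simpa using hz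
  have h2 : ‖z‖ ^ 2 < 1 := by nlinarith [norm_nonneg z]
  have hlim := ((F.hasSum_coeff hz).norm.pow 2)
  refine le_of_tendsto hlim (Eventually.of_forall fun s => ?_)
  have h3 : ‖∑ n ∈ s, z ^ n • coeff F n‖ ≤ ∑ n ∈ s, ‖z‖ ^ n * ‖coeff F n‖ :=
    (norm_sum_le _ _).trans (le_of_eq (Finset.sum_congr rfl fun n _ => by
      rw [norm_smul, norm_pow]))
  have h4 : ∑ n ∈ s, (‖z‖ ^ n) ^ 2 ≤ (1 - ‖z‖ ^ 2)⁻¹ := by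
    rw [← tsum_geometric_of_lt_one (by positivity) h2]
    simp only [← pow_mul, mul_comm _ 2]
    simp only [pow_mul]
    exact (summable_geometric_of_lt_one (by positivity) h2).sum_le_tsum s
      fun n _ => by positivity
  calc ‖∑ n ∈ s, z ^ n • coeff F n‖ ^ 2
      ≤ (∑ n ∈ s, ‖z‖ ^ n * ‖coeff F n‖) ^ 2 := by gcongr
    _ ≤ (∑ n ∈ s, (‖z‖ ^ n) ^ 2) * ∑ n ∈ s, ‖coeff F n‖ ^ 2 :=
        Finset.sum_mul_sq_le_sq_mul_sq _ _ _
    _ ≤ _ := mul_le_mul h4 (F.sum_norm_coeff_sq_le s) (by positivity)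
        (inv_nonneg.2 (by linarith))

/-- Evaluation at a point of the disc. -/
def evalCLM {z : ℂ} (hz : z ∈ Metric.ball (0 : ℂ) 1) : H2 E →L[ℂ] E :=
  LinearMap.mkContinuous
    { toFun := fun F => F z
      map_add' := fun _ _ => rfl
      map_smul' := fun _ _ => rfl } √(1 - ‖z‖ ^ 2)⁻¹ fun F => by
    have h := Real.sqrt_le_sqrt (F.norm_apply_sq_le hz)
    rw [Real.sqrt_sq (norm_nonneg _), Real.sqrt_mul' _ (sq_nonneg _),
      Real.sqrt_sq (norm_nonneg _)] at h
    exact h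

/-! ### The shift -/

omit [CompleteSpace E] in
lemma shift_apply (F : H2 E) (z : ℂ) : shift F z = z • F z := rfl

omit [CompleteSpace E] in
lemma shift_pow_apply (n : ℕ) (F : H2 E) (z : ℂ) : (shift ^ n) F z = z ^ n • F z := by
  induction n with
  | zero => simp
  | succ n ih => rw [pow_succ', Module.End.mul_apply, shift_apply, ih, smul_smul, pow_succ']

lemma coeff_shift (F : H2 E) : coeff (shift F) = fun n => Nat.casesOn n 0 (coeff F) := by
  apply coeff_eq
  intro z hz
  rw [← hasSum_nat_add_iff' 1]
  have := (F.hasSum_coeff hz).const_smul z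
  simpa [shift_apply, smul_smul, pow_succ'] using this

@[simp] lemma norm_shift (F : H2 E) : ‖shift F‖ = ‖F‖ := by
  refine (sq_eq_sq₀ (norm_nonneg _) (norm_nonneg _)).1 ?_
  rw [norm_sq_eq_tsum, norm_sq_eq_tsum, (shift F).summable_norm_coeff_sq.tsum_eq_zero_add,
    coeff_shift]
  simp

variable (E) in
/-- The shift as an isometry. -/
def shiftₗᵢ : H2 E →ₗᵢ[ℂ] H2 E := ⟨shift, norm_shift⟩

lemma norm_shift_pow (n : ℕ) (F : H2 E) : ‖(shift ^ n) F‖ = ‖F‖ := by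
  induction n with
  | zero => simp
  | succ n ih => rw [pow_succ', Module.End.mul_apply, norm_shift, ih]

lemma coeff_shift_pow_of_lt (F : H2 E) {n k : ℕ} (h : k < n) : coeff ((shift ^ n) F) k = 0 := by
  induction n generalizing k with
  | zero => omega
  | succ n ih =>
    rw [pow_succ', Module.End.mul_apply, coeff_shift]
    cases k with
    | zero => rfl
    | succ k => exact ih (by omega)

/-- The shift has no unitary part. -/
lemma eq_zero_of_forall_mem_range_shift_pow {F : H2 E} (h : ∀ n, ∃ G, (shift ^ n) G = F) :
    F = 0 := by
  have hz : coeff (0 : H2 E) = 0 := coeff_eq fun z _ => by simp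
  apply ext_coeff
  rw [hz]
  funext k
  obtain ⟨G, rfl⟩ := h (k + 1)
  exact coeff_shift_pow_of_lt G k.lt_succ_self

end H2
end Parseval

/-! ### The isometry `T` -/

section Interleave

variable {m : ℕ} [NeZero m]

namespace H2

/-- The Taylor coefficients of `∑ zˡ Fₗ(zᵐ)`: the coordinates of those of `F`, listed one after the
other. -/
def interleave (a : ℕ → Cn m) (j : ℕ) : ℂ :=
  a (Nat.divModEquiv m j).1 (Nat.divModEquiv m j).2

lemma hasSum_norm_interleave_sq {a : ℕ → Cn m} (ha : Summable fun n => ‖a n‖ ^ 2) :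
    HasSum (fun j => ‖interleave a j‖ ^ 2) (∑' n, ‖a n‖ ^ 2) := by
  have h1 : Summable fun p : ℕ × Fin m => ‖a p.1 p.2‖ ^ 2 := by
    rw [summable_prod_of_nonneg fun _ => by positivity]
    refine ⟨fun n => (hasSum_fintype _).summable, ?_⟩
    simpa only [tsum_fintype, ← EuclideanSpace.norm_sq_eq] using ha
  have h2 := (Nat.divModEquiv m).hasSum_iff.2 h1.hasSum
  rw [h1.tsum_prod] at h2
  simp only [tsum_fintype, ← EuclideanSpace.norm_sq_eq] at h2
  exact h2

lemma pow_mem_unitBall {z : ℂ} (hz : z ∈ Metric.ball (0 : ℂ) 1) :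
    z ^ m ∈ Metric.ball (0 : ℂ) 1 := by
  have : ‖z‖ < 1 := by simpa using hz
  simpa using pow_lt_one₀ (norm_nonneg z) this (NeZero.ne m)

lemma hasSum_pow_smul_interleave (F : H2 (Cn m)) (f : H2 ℂ)
    (hf : coeff f = interleave (coeff F)) {z : ℂ} (hz : z ∈ Metric.ball (0 : ℂ) 1) :
    f z = ∑ l : Fin m, z ^ (l : ℕ) * F (z ^ m) l := by
  have h1 := f.hasSum_coeff hz
  rw [hf] at h1
  have h2 : HasSum (fun p : ℕ × Fin m => z ^ (p.1 * m + p.2) • coeff F p.1 p.2) (f z) := by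
    rw [← (Nat.divModEquiv m).hasSum_iff]
    convert! h1 using 2 with j
    have : (Nat.divModEquiv m j).1 * m + (Nat.divModEquiv m j).2 = j :=
      (Nat.divModEquiv m).symm_apply_apply j
    simp only [Function.comp_apply, this, interleave]
  have h3 := h2.prod_fiberwise fun n => hasSum_fintype _
  refine h3.unique ?_
  have h4 := fun l : Fin m =>
    ((EuclideanSpace.proj l).hasSum (F.hasSum_coeff (pow_mem_unitBall (m := m) hz))).mul_left
      (z ^ (l : ℕ))
  convert! hasSum_sum fun l (_ : l ∈ Finset.univ) => h4 l using 2 with n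
  refine Finset.sum_congr rfl fun l _ => ?_
  simp only [map_smul, PiLp.proj_apply, smul_eq_mul]
  ring

/-- The function `∑ zˡ Fₗ(zᵐ)`, given by its Taylor coefficients. -/
def interleaveFun (F : H2 (Cn m)) : H2 ℂ :=
  ofCoeff (interleave (coeff F)) (hasSum_norm_interleave_sq F.summable_norm_coeff_sq).summable

lemma coeff_interleaveFun (F : H2 (Cn m)) : coeff (interleaveFun F) = interleave (coeff F) :=
  coeff_ofCoeff _ _

variable (m) in
/-- The isometric isomorphism `(f₀, …, f_{m-1}) ↦ ∑ zˡ fₗ(zᵐ)`. -/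
def interleaveEquiv : H2 (Cn m) ≃ₗᵢ[ℂ] H2 ℂ :=
  LinearIsometryEquiv.ofSurjective
    { toFun := interleaveFun
      map_add' := fun F G => ext_coeff (by
        rw [coeff_add, coeff_interleaveFun, coeff_interleaveFun, coeff_interleaveFun, coeff_add]
        rfl)
      map_smul' := fun c F => ext_coeff (by
        rw [coeff_smul, coeff_interleaveFun, coeff_interleaveFun, coeff_smul]
        rfl)
      norm_map' := fun F => by
        refine (sq_eq_sq₀ (norm_nonneg _) (norm_nonneg _)).1 ?_
        rw [norm_sq_eq_tsum, norm_sq_eq_tsum]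
        refine Eq.trans ?_ (hasSum_norm_interleave_sq F.summable_norm_coeff_sq).tsum_eq
        rw [← coeff_interleaveFun]
        rfl }
    fun f => by
      set a : ℕ → Cn m := fun n => WithLp.toLp 2 fun l => coeff f ((Nat.divModEquiv m).symm (n, l))
        with ha
      have h1 : Summable fun p : ℕ × Fin m => ‖coeff f ((Nat.divModEquiv m).symm p)‖ ^ 2 :=
        (Nat.divModEquiv m).symm.summable_iff.2 f.summable_norm_coeff_sq
      rw [summable_prod_of_nonneg fun _ => by positivity] at h1
      have h2 : Summable fun n => ‖a n‖ ^ 2 := by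
        simpa only [EuclideanSpace.norm_sq_eq, tsum_fintype] using h1.2
      refine ⟨ofCoeff a h2, ext_coeff ((coeff_interleaveFun _).trans ?_)⟩
      rw [coeff_ofCoeff]
      funext j
      exact congrArg (coeff f) ((Nat.divModEquiv m).symm_apply_apply j)

lemma interleaveEquiv_apply (F : H2 (Cn m)) {z : ℂ} (hz : z ∈ Metric.ball (0 : ℂ) 1) :
    interleaveEquiv m F z = ∑ l : Fin m, z ^ (l : ℕ) * F (z ^ m) l :=
  hasSum_pow_smul_interleave F (interleaveFun F) (coeff_interleaveFun F) hz

lemma interleaveEquiv_shift (F : H2 (Cn m)) :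
    interleaveEquiv m (shift F) = (shift ^ m) (interleaveEquiv m F) := by
  ext z hz
  rw [shift_pow_apply, interleaveEquiv_apply _ hz, interleaveEquiv_apply _ hz, smul_eq_mul,
    Finset.mul_sum]
  refine Finset.sum_congr rfl fun l _ => ?_
  rw [shift_apply, PiLp.smul_apply, smul_eq_mul]
  ring

end H2
end Interleave

/-! ### Isometries commuting with the shift are multiplications -/

section Multiplier

variable {r n : ℕ}

/-- An operator valued function is analytic if it is so on each vector. -/
lemma differentiableOn_of_forall_apply {Φ : ℂ → Cn r →L[ℂ] Cn n} {s : Set ℂ}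
    (h : ∀ c, DifferentiableOn ℂ (fun z => Φ z c) s) : DifferentiableOn ℂ Φ s := by
  have hΦ : Φ = fun z => ∑ j : Fin r,
      ContinuousLinearMap.smulRightL ℂ (Cn r) (Cn n) (EuclideanSpace.proj j)
        (Φ z (EuclideanSpace.single j 1)) := by
    funext z
    ext1 c
    have hc : c = ∑ j : Fin r, c j • EuclideanSpace.single j (1 : ℂ) := by
      ext i
      simp [Finset.sum_apply, Pi.single_apply]
    conv_lhs => rw [hc]
    simp [map_sum]
  rw [hΦ]
  refine DifferentiableOn.fun_sum fun j _ => ?_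
  exact (ContinuousLinearMap.differentiable _).comp_differentiableOn (h _)

namespace H2

variable {E : Type*} [NormedAddCommGroup E] [InnerProductSpace ℂ E] [CompleteSpace E]

variable (E) in
/-- The constant functions. -/
def const : E →ₗᵢ[ℂ] H2 E :=
  (coeffEquiv E).symm.toLinearIsometry.comp
    ⟨lp.lsingle (E := fun _ : ℕ => E) 2 0, fun c =>
      lp.norm_single (E := fun _ : ℕ => E) (p := 2) zero_lt_two 0 c⟩

lemma coeffEquiv_symm_single_apply (k : ℕ) (c : E) {z : ℂ} (hz : z ∈ Metric.ball (0 : ℂ) 1) :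
    (coeffEquiv E).symm (lp.single 2 k c) z = z ^ k • c := by
  have h := ((coeffEquiv E).symm (lp.single 2 k c)).hasSum_coeff hz
  simp only [← coeffEquiv_apply, LinearIsometryEquiv.apply_symm_apply, lp.single_apply] at h
  refine h.unique ?_
  convert! hasSum_ite_eq k (z ^ k • c) using 2 with j
  rw [Pi.single_apply]
  split_ifs with hj
  · rw [hj]
  · rw [smul_zero]

@[simp] lemma const_apply (c : E) {z : ℂ} (hz : z ∈ Metric.ball (0 : ℂ) 1) : const E c z = c :=
  (coeffEquiv_symm_single_apply 0 c hz).trans (by simp)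

/-- The Taylor series of `F` converges to `F` in `H²`. -/
lemma hasSum_shift_pow_const (F : H2 E) :
    HasSum (fun n => (shift ^ n) (const E (coeff F n))) F := by
  have h := (coeffEquiv E).symm.toContinuousLinearEquiv.hasSum'.2
    (lp.hasSum_single (p := 2) (by norm_num) (coeffEquiv E F))
  convert! h using 1
  · funext n
    ext z hz
    rw [shift_pow_apply, const_apply _ hz]
    exact (coeffEquiv_symm_single_apply n _ hz).symm
  · exact ((coeffEquiv E).symm_apply_apply F).symm

/-- The reproducing kernel `∑ (conj a)ⁿ zⁿ c`, for which the bound on point evaluation at `a` is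
attained. -/
lemma exists_kernel {a : ℂ} (ha : a ∈ Metric.ball (0 : ℂ) 1) (c : E) :
    ∃ F : H2 E, F a = (1 - ‖a‖ ^ 2)⁻¹ • c ∧ ‖F‖ ^ 2 = (1 - ‖a‖ ^ 2)⁻¹ * ‖c‖ ^ 2 := by
  have h1 : ‖a‖ < 1 := by simpa using ha
  have h2 : ‖a‖ ^ 2 < 1 := by nlinarith [norm_nonneg a]
  have hg := hasSum_geometric_of_lt_one (sq_nonneg ‖a‖) h2
  have hs : HasSum (fun n => ‖(starRingEnd ℂ) a ^ n • c‖ ^ 2) ((1 - ‖a‖ ^ 2)⁻¹ * ‖c‖ ^ 2) := by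
    convert! hg.mul_right (‖c‖ ^ 2) using 2 with n
    rw [norm_smul, norm_pow, RCLike.norm_conj]
    ring
  refine ⟨ofCoeff _ hs.summable, ?_, ?_⟩
  · have h3 := (ofCoeff _ hs.summable).hasSum_coeff ha
    rw [coeff_ofCoeff] at h3
    refine h3.unique ?_
    convert! hg.smul_const c using 2 with n
    rw [smul_smul, ← mul_pow, Complex.mul_conj, Complex.normSq_eq_norm_sq, ← Complex.ofReal_pow]
    exact Complex.coe_smul _ _
  · rw [norm_sq_eq_tsum, coeff_ofCoeff, hs.tsum_eq]

end H2

open H2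

/-- An isometry of Hardy spaces commuting with the shifts is multiplication by an analytic function
all of whose values are contractions. -/
theorem exists_multiplier (X : H2 (Cn r) →ₗᵢ[ℂ] H2 (Cn n))
    (hX : ∀ F, X (H2.shift F) = H2.shift (X F)) :
    ∃ Φ : ℂ → Cn r →L[ℂ] Cn n, DifferentiableOn ℂ Φ (Metric.ball 0 1) ∧
      (∀ z ∈ Metric.ball (0 : ℂ) 1, ‖Φ z‖ ≤ 1) ∧
      ∀ F, ∀ z ∈ Metric.ball (0 : ℂ) 1, X F z = Φ z (F z) := by
  classical
  set Φ : ℂ → Cn r →L[ℂ] Cn n := fun z =>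
    if hz : z ∈ Metric.ball (0 : ℂ) 1 then
      evalCLM hz ∘L X.toContinuousLinearMap ∘L (const (Cn r)).toContinuousLinearMap else 0 with hΦ
  have hΦa : ∀ c, ∀ z ∈ Metric.ball (0 : ℂ) 1, Φ z c = X (const _ c) z := by
    intro c z hz
    simp only [hΦ, dif_pos hz]
    rfl
  have hXn : ∀ k F, X ((H2.shift ^ k) F) = (H2.shift ^ k) (X F) := by
    intro k F
    induction k with
    | zero => simp
    | succ k ih => rw [pow_succ', Module.End.mul_apply, hX, ih, pow_succ', Module.End.mul_apply]
  have hmul : ∀ F, ∀ z ∈ Metric.ball (0 : ℂ) 1, X F z = Φ z (F z) := by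
    intro F z hz
    have h1 := (evalCLM hz ∘L X.toContinuousLinearMap).hasSum F.hasSum_shift_pow_const
    have h2 := (Φ z).hasSum (F.hasSum_coeff hz)
    refine h1.unique ?_
    convert! h2 using 2 with k
    change X ((H2.shift ^ k) _) z = _
    rw [hXn, shift_pow_apply, map_smul, hΦa _ _ hz]
  refine ⟨Φ, differentiableOn_of_forall_apply fun c => ?_, fun z hz => ?_, hmul⟩
  · exact (X (const _ c)).differentiableOn.congr fun z hz => hΦa c z hz
  · refine ContinuousLinearMap.opNorm_le_bound _ zero_le_one fun c => ?_
    obtain ⟨F, hF, hFn⟩ := exists_kernel hz c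
    have h1 := (X F).norm_apply_sq_le hz
    have hz1 : ‖z‖ < 1 := by simpa using hz
    have hs : 0 < (1 - ‖z‖ ^ 2)⁻¹ := inv_pos.2 (by nlinarith [norm_nonneg z])
    rw [hmul F z hz, X.norm_map, hF, hFn, ContinuousLinearMap.map_smul_of_tower, norm_smul, Real.norm_of_nonneg hs.le,
      mul_pow, ← mul_assoc, ← sq] at h1
    rw [one_mul]
    exact le_of_sq_le_sq (le_of_mul_le_mul_left h1 (by positivity)) (norm_nonneg _)

end Multiplier

/-! ### Boundary values of isometric multipliers -/

section Inner

lemma ae_of_periodic {P : ℝ → Prop} (hP : Function.Periodic P (2 * Real.pi))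
    (h : ∀ᵐ t : ℝ, t ∈ Ioc 0 (2 * Real.pi) → P t) : ∀ᵐ t : ℝ, P t := by
  have h1 : ∀ᵐ t : ℝ, ∀ k : ℤ, t + -(k • (2 * Real.pi)) ∈ Ioc 0 (2 * Real.pi) →
      P (t + -(k • (2 * Real.pi))) := by
    rw [ae_all_iff]
    intro k
    exact (measurePreserving_add_right volume _).quasiMeasurePreserving.ae h
  filter_upwards [h1] with t ht
  have h2 := ht (toIocDiv Real.two_pi_pos 0 t) (by
    have h3 := toIocMod_mem_Ioc Real.two_pi_pos 0 t
    rw [zero_add] at h3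
    rw [← sub_eq_add_neg]
    exact h3)
  rwa [← sub_eq_add_neg, hP.sub_zsmul_eq] at h2

variable {r n : ℕ}

lemma HasBoundaryValue.periodic (Φ : ℂ → Cn r →L[ℂ] Cn n) (L : Cn r →L[ℂ] Cn n) (t : ℝ) :
    HasBoundaryValue Φ (t + 2 * Real.pi) L ↔ HasBoundaryValue Φ t L := by
  unfold HasBoundaryValue
  have h : ∀ ρ : ℝ, circleMap 0 ρ (t + 2 * Real.pi) = circleMap 0 ρ t := fun ρ =>
    periodic_circleMap 0 ρ t
  simp only [h]

lemma meanSq_mono {E : Type*} [NormedAddCommGroup E] [InnerProductSpace ℂ E] [CompleteSpace E]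
    (F : H2 E) {ρ ρ' : ℝ} (h0 : 0 < ρ) (h : ρ ≤ ρ') (h1 : ρ' < 1) :
    meanSq F ρ ≤ meanSq F ρ' := by
  refine hasSum_le (fun k => ?_) (hasSum_meanSq (fun z hz => F.hasSum_coeff hz) ⟨h0, by linarith⟩)
    (hasSum_meanSq (fun z hz => F.hasSum_coeff hz) ⟨by linarith, h1⟩)
  gcongr

/-- The boundary values of a contractive multiplier preserve the norm of `c` if multiplication
of the constant function `c` does: the pointwise inequality `‖L c‖ ≤ ‖c‖` is an equality in the
mean. -/
lemma ae_norm_boundaryValue_apply_eq {Φ : ℂ → Cn r →L[ℂ] Cn n}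
    (hd : DifferentiableOn ℂ Φ (Metric.ball 0 1))
    (hb : ∀ z ∈ Metric.ball (0 : ℂ) 1, ‖Φ z‖ ≤ 1) {c : Cn r} {F : H2 (Cn n)}
    (hFc : ‖F‖ = ‖c‖) (hF : ∀ z ∈ Metric.ball (0 : ℂ) 1, F z = Φ z c) :
    ∀ᵐ t : ℝ, ∀ L, HasBoundaryValue Φ t L → ‖L c‖ = ‖c‖ := by
  apply ae_of_periodic
  · intro t
    simp only [HasBoundaryValue.periodic]
  obtain ⟨L, hL⟩ := (ae_exists_tendsto_radial hd hb).choice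
  have hmem : ∀ ρ ∈ Ioo (0 : ℝ) 1, ∀ t, circleMap 0 ρ t ∈ Metric.ball (0 : ℂ) 1 := by
    intro ρ hρ t
    simpa [abs_of_pos hρ.1] using hρ.2
  have hev : ∀ᶠ ρ : ℝ in 𝓝[<] 1, ρ ∈ Ioo (0 : ℝ) 1 := Ioo_mem_nhdsLT one_pos
  set v : ℝ → ℝ := fun t => ‖L t c‖ ^ 2 with hv
  have hlim : ∀ᵐ t : ℝ, Tendsto (fun ρ : ℝ => ‖F (circleMap 0 ρ t)‖ ^ 2) (𝓝[<] 1) (𝓝 (v t)) := by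
    filter_upwards [hL] with t ht
    have h1 : Tendsto (fun ρ : ℝ => Φ (circleMap 0 ρ t) c) (𝓝[<] 1) (𝓝 (L t c)) :=
      ((ContinuousLinearMap.apply ℂ (Cn n) c).continuous.tendsto (L t)).comp ht
    refine (h1.norm.pow 2).congr' ?_
    filter_upwards [hev] with ρ hρ
    rw [hF _ (hmem ρ hρ t)]
  have hFle : ∀ z ∈ Metric.ball (0 : ℂ) 1, ‖F z‖ ^ 2 ≤ ‖c‖ ^ 2 := by
    intro z hz
    rw [hF z hz]
    gcongr
    simpa using (Φ z).le_of_opNorm_le (hb z hz) c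
  have hmeas : ∀ᶠ ρ : ℝ in 𝓝[<] 1, Continuous fun t => ‖F (circleMap 0 ρ t)‖ ^ 2 := by
    filter_upwards [hev] with ρ hρ
    exact (F.differentiableOn.continuousOn.comp_continuous (continuous_circleMap 0 ρ)
      (hmem ρ hρ)).norm.pow 2
  have hvle : ∀ᵐ t : ℝ, v t ≤ ‖c‖ ^ 2 := by
    filter_upwards [hlim] with t ht
    refine le_of_tendsto ht ?_
    filter_upwards [hev] with ρ hρ
    exact hFle _ (hmem ρ hρ t)
  have hint : Tendsto (fun ρ : ℝ => ∫ t in (0 : ℝ)..2 * Real.pi, ‖F (circleMap 0 ρ t)‖ ^ 2)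
      (𝓝[<] 1) (𝓝 (∫ t in (0 : ℝ)..2 * Real.pi, v t)) := by
    apply intervalIntegral.tendsto_integral_filter_of_dominated_convergence fun _ => ‖c‖ ^ 2
    · filter_upwards [hmeas] with ρ hρ
      exact hρ.aestronglyMeasurable
    · filter_upwards [hev] with ρ hρ
      refine Eventually.of_forall fun t _ => ?_
      rw [Real.norm_of_nonneg (by positivity)]
      exact hFle _ (hmem ρ hρ t)
    · exact intervalIntegrable_const
    · filter_upwards [hlim] with t ht _ using ht
  have hge : ‖c‖ ^ 2 ≤ (2 * Real.pi)⁻¹ * ∫ t in (0 : ℝ)..2 * Real.pi, v t := by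
    rw [← hFc]
    refine H2.norm_sq_le fun ρ hρ => ?_
    refine ge_of_tendsto (hint.const_mul (2 * Real.pi)⁻¹) ?_
    filter_upwards [Ioo_mem_nhdsLT hρ.2] with ρ' hρ'
    exact meanSq_mono F hρ.1 hρ'.1.le hρ'.2
  have hvm : AEStronglyMeasurable v volume := by
    obtain ⟨u, -, hu, hu1⟩ := exists_seq_strictMono_tendsto' (zero_lt_one (α := ℝ))
    have hu2 : Tendsto u atTop (𝓝[<] 1) :=
      tendsto_nhdsWithin_iff.2 ⟨hu1, Eventually.of_forall fun k => (hu k).2⟩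
    refine aestronglyMeasurable_of_tendsto_ae atTop
      (f := fun k t => ‖F (circleMap 0 (u k) t)‖ ^ 2) (fun k => ?_) ?_
    · exact ((F.differentiableOn.continuousOn.comp_continuous (continuous_circleMap 0 (u k))
        (hmem _ (hu k))).norm.pow 2).aestronglyMeasurable
    · filter_upwards [hlim] with t ht using ht.comp hu2
  have hvi : IntervalIntegrable v volume 0 (2 * Real.pi) := by
    refine (intervalIntegrable_const (c := ‖c‖ ^ 2)).mono_fun' hvm.restrict ?_
    refine ae_restrict_of_ae ?_
    filter_upwards [hvle] with t ht
    rwa [Real.norm_of_nonneg (by positivity)]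
  have hzero : ∫ t in (0 : ℝ)..2 * Real.pi, (‖c‖ ^ 2 - v t) = 0 := by
    apply le_antisymm
    · rw [intervalIntegral.integral_sub intervalIntegrable_const hvi,
        intervalIntegral.integral_const, smul_eq_mul, sub_zero]
      have := mul_le_mul_of_nonneg_left hge Real.two_pi_pos.le
      rw [mul_inv_cancel_left₀ Real.two_pi_pos.ne'] at this
      linarith
    · refine intervalIntegral.integral_nonneg_of_ae_restrict Real.two_pi_pos.le
        (ae_restrict_of_ae ?_)
      filter_upwards [hvle] with t ht
      simpa using ht
  rw [intervalIntegral.integral_eq_zero_iff_of_le_of_nonneg_ae Real.two_pi_pos.le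
    (ae_restrict_of_ae (by filter_upwards [hvle] with t ht; simpa using ht))
    (intervalIntegrable_const.sub hvi)] at hzero
  have hzero' := (ae_restrict_iff' measurableSet_Ioc).1 hzero
  filter_upwards [hzero', hL] with t ht hLt htm L' hL'
  have h1 : L' = L t := tendsto_nhds_unique hL' hLt
  have h2 : ‖c‖ ^ 2 - ‖L t c‖ ^ 2 = 0 := ht htm
  rw [h1]
  exact (sq_eq_sq₀ (norm_nonneg _) (norm_nonneg _)).1 (by linarith)

/-- An isometric multiplier is inner. -/
theorem isInner_of_isometry {Φ : ℂ → Cn r →L[ℂ] Cn n}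
    (hd : DifferentiableOn ℂ Φ (Metric.ball 0 1))
    (hb : ∀ z ∈ Metric.ball (0 : ℂ) 1, ‖Φ z‖ ≤ 1)
    (hF : ∀ c, ∃ F : H2 (Cn n), ‖F‖ = ‖c‖ ∧ ∀ z ∈ Metric.ball (0 : ℂ) 1, F z = Φ z c) :
    IsInner Φ := by
  refine ⟨⟨hd, 1, hb⟩, ?_⟩
  -- a countable dense set of vectors, so that the exceptional null sets may be united
  have h : ∀ᵐ t : ℝ, ∀ k : ℕ, ∀ L, HasBoundaryValue Φ t L →
      ‖L (TopologicalSpace.denseSeq (Cn r) k)‖ = ‖TopologicalSpace.denseSeq (Cn r) k‖ := by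
    rw [ae_all_iff]
    intro k
    obtain ⟨F, h1, h2⟩ := hF (TopologicalSpace.denseSeq (Cn r) k)
    exact ae_norm_boundaryValue_apply_eq hd hb h1 h2
  filter_upwards [h, ae_exists_tendsto_radial hd hb] with t ht ⟨L, hL⟩
  refine ⟨L, hL, AddMonoidHomClass.isometry_of_norm L fun c => ?_⟩
  have h1 : (fun c => ‖L c‖) = fun c => ‖c‖ :=
    (TopologicalSpace.denseRange_denseSeq (Cn r)).equalizer L.continuous.norm continuous_norm
      (funext fun k => ht k L hL)
  exact congrFun h1 c

end Inner

/-! ### Wandering subspaces -/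

section Wold

variable {H : Type*} [NormedAddCommGroup H] [InnerProductSpace ℂ H] [CompleteSpace H]

omit [CompleteSpace H] in
lemma _root_.LinearIsometry.mul_apply (A B : H →ₗᵢ[ℂ] H) (x : H) : (A * B) x = A (B x) := rfl

omit [CompleteSpace H] in
lemma pow_apply_mem {S : H →ₗᵢ[ℂ] H} {N : Submodule ℂ H} (hN : ∀ x ∈ N, S x ∈ N) (k : ℕ) {x : H}
    (hx : x ∈ N) : (S ^ k) x ∈ N := by
  induction k with
  | zero => exact hx
  | succ k ih => rw [pow_succ', LinearIsometry.mul_apply]; exact hN _ ih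

/-- An isometry `V` into the wandering subspace `N ⊖ S N` extends to an isometry from the Hardy
space which intertwines the shift with `S`. -/
theorem exists_isometry_of_wandering {S : H →ₗᵢ[ℂ] H} {N : Submodule ℂ H}
    (hN : ∀ x ∈ N, S x ∈ N) {r : ℕ} (V : Cn r →ₗᵢ[ℂ] H) (hV : ∀ c, V c ∈ N)
    (hVo : ∀ c, ∀ y ∈ N, inner ℂ (V c) (S y) = 0) :
    ∃ X : H2 (Cn r) →ₗᵢ[ℂ] H, (∀ F, X (H2.shift F) = S (X F)) ∧
      LinearMap.range X.toLinearMap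
        = (⨆ k : ℕ, LinearMap.range ((S ^ k).comp V).toLinearMap).topologicalClosure := by
  have horth : ∀ i j, i < j → ∀ c d, inner ℂ ((S ^ i) (V c)) ((S ^ j) (V d)) = 0 := by
    intro i j hij c d
    obtain ⟨k, rfl⟩ := Nat.exists_eq_add_of_lt hij
    rw [add_assoc, pow_add, LinearIsometry.mul_apply, LinearIsometry.inner_map_map, pow_succ',
      LinearIsometry.mul_apply]
    exact hVo c _ (pow_apply_mem hN k (hV d))
  have hfam : OrthogonalFamily ℂ (fun _ : ℕ => Cn r) fun k => (S ^ k).comp V := by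
    intro i j hij c d
    rcases lt_or_gt_of_ne hij with h | h
    · exact horth i j h c d
    · exact inner_eq_zero_symm.1 (horth j i h d c)
  set X := hfam.linearIsometry.comp (H2.coeffEquiv (Cn r)).toLinearIsometry with hX
  have hXs : ∀ F, HasSum (fun k => (S ^ k) (V (H2.coeff F k))) (X F) := fun F =>
    hfam.hasSum_linearIsometry (H2.coeffEquiv _ F)
  refine ⟨X, fun F => ?_, ?_⟩
  · refine (hXs _).unique ?_
    rw [← hasSum_nat_add_iff' 1]
    have h1 := S.toContinuousLinearMap.hasSum (hXs F)
    simpa [H2.coeff_shift, pow_succ'] using h1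
  · rw [← hfam.range_linearIsometry]
    exact LinearMap.range_comp_of_range_eq_top _ (LinearEquiv.range _)

/-- **Wold decomposition** for an isometry without unitary part: an invariant subspace `N` is the
closed span of the images of its wandering subspace `N ⊖ S N`. -/
theorem eq_closure_iSup_range_of_wandering {S : H →ₗᵢ[ℂ] H}
    (hS : ∀ x, (∀ k : ℕ, ∃ y, (S ^ k) y = x) → x = 0) {N : Submodule ℂ H}
    (hNc : IsClosed (N : Set H)) (hN : ∀ x ∈ N, S x ∈ N) {r : ℕ} (V : Cn r →ₗᵢ[ℂ] H)
    (hV : ∀ x, x ∈ LinearMap.range V.toLinearMap ↔ x ∈ N ⊓ (N.map S.toLinearMap)ᗮ) :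
    (⨆ k : ℕ, LinearMap.range ((S ^ k).comp V).toLinearMap).topologicalClosure = N := by
  set K := (⨆ k : ℕ, LinearMap.range ((S ^ k).comp V).toLinearMap).topologicalClosure with hK
  have hKN : K ≤ N := by
    refine Submodule.topologicalClosure_minimal _ (iSup_le fun k => ?_) hNc
    rintro _ ⟨c, rfl⟩
    exact pow_apply_mem hN k ((hV _).1 ⟨c, rfl⟩).1
  refine le_antisymm hKN fun x hx => ?_
  have : CompleteSpace N := hNc.completeSpace_coe
  have : CompleteSpace K := (Submodule.isClosed_topologicalClosure _).completeSpace_coe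
  have : CompleteSpace (N.map S.toLinearMap) := LinearIsometry.completeSpace_map S N
  have hSN : N.map S.toLinearMap ≤ N := by
    rintro _ ⟨y, hy, rfl⟩
    exact hN y hy
  obtain ⟨p, hp, q, hq, rfl⟩ := K.exists_add_mem_mem_orthogonal x
  have hqN : q ∈ N := by simpa using N.sub_mem hx (hKN hp)
  suffices hq0 : q = 0 by rwa [hq0, add_zero]
  have hqo : ∀ k : ℕ, ∀ w ∈ LinearMap.range V.toLinearMap, inner ℂ ((S ^ k) w) q = 0 := by
    rintro k _ ⟨c, rfl⟩
    refine hq _ (Submodule.le_topologicalClosure _ (Submodule.mem_iSup_of_mem k ⟨c, rfl⟩))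
  have key : ∀ k : ℕ, ∃ g ∈ N, (S ^ k) g = q := by
    intro k
    induction k with
    | zero => exact ⟨q, hqN, rfl⟩
    | succ k ih =>
      obtain ⟨g, hg, hgq⟩ := ih
      obtain ⟨a, ha, b, hb, rfl⟩ := (N.map S.toLinearMap).exists_add_mem_mem_orthogonal g
      have hbN : b ∈ N := by simpa using N.sub_mem hg (hSN ha)
      have h1 := hqo k b ((hV b).2 ⟨hbN, hb⟩)
      rw [← hgq, LinearIsometry.inner_map_map, inner_add_right,
        inner_eq_zero_symm.1 (hb a ha), zero_add, inner_self_eq_zero] at h1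
      obtain ⟨y, hy, rfl⟩ := ha
      refine ⟨y, hy, ?_⟩
      rw [pow_succ, LinearIsometry.mul_apply, ← hgq, h1, add_zero]
      rfl
  exact hS q fun k => let ⟨g, _, hg⟩ := key k; ⟨g, hg⟩

end Wold

/-! ### Shift invariant subspaces -/

section BeurlingLaxHalmos

variable {m : ℕ}

lemma shiftₗᵢ_pow_apply (k : ℕ) (F : H2 (Cn m)) :
    (H2.shiftₗᵢ (Cn m) ^ k) F = (H2.shift ^ k) F := by
  induction k with
  | zero => rfl
  | succ k ih =>
    rw [pow_succ', pow_succ', LinearIsometry.mul_apply, ih, Module.End.mul_apply]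
    rfl

/-- The wandering subspace of a shift invariant subspace of `H²(𝔻, ℂᵐ)` contains at most `m`
orthonormal vectors: they are the columns of an inner function, whose boundary values embed `ℂʳ`
into `ℂᵐ`. -/
lemma le_of_wandering {N : Submodule ℂ (H2 (Cn m))} (hN : ∀ F ∈ N, H2.shift F ∈ N) {r : ℕ}
    (V : Cn r →ₗᵢ[ℂ] H2 (Cn m)) (hV : ∀ c, V c ∈ N)
    (hVo : ∀ c, ∀ F ∈ N, inner ℂ (V c) (H2.shift F) = 0) : r ≤ m := by
  obtain ⟨X, hX, -⟩ := exists_isometry_of_wandering (S := H2.shiftₗᵢ (Cn m)) hN V hV hVo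
  obtain ⟨Φ, hd, hb, hΦ⟩ := exists_multiplier X hX
  have hin : IsInner Φ := isInner_of_isometry hd hb fun c =>
    ⟨X (H2.const _ c), by simp, fun z hz => by rw [hΦ _ z hz, H2.const_apply c hz]⟩
  obtain ⟨t, L, -, hL⟩ := hin.2.exists
  simpa using LinearMap.finrank_le_finrank_of_injective (f := (L : Cn r →ₗ[ℂ] Cn m)) hL.injective

/-- **Beurling–Lax–Halmos theorem**, in operator form: a closed shift invariant subspace of
`H²(𝔻, ℂᵐ)` is the range of an isometry of `H²(𝔻, ℂʳ)`, `r ≤ m`, which commutes with the shifts. -/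
theorem exists_isometry_range_eq {N : Submodule ℂ (H2 (Cn m))}
    (hNc : IsClosed (N : Set (H2 (Cn m)))) (hN : ∀ F ∈ N, H2.shift F ∈ N) :
    ∃ r ≤ m, ∃ X : H2 (Cn r) →ₗᵢ[ℂ] H2 (Cn m), (∀ F, X (H2.shift F) = H2.shift (X F)) ∧
      LinearMap.range X.toLinearMap = N := by
  set S := H2.shiftₗᵢ (Cn m) with hS
  set W : Submodule ℂ (H2 (Cn m)) := N ⊓ (N.map S.toLinearMap)ᗮ with hW
  have hWo : ∀ w ∈ W, ∀ F ∈ N, inner ℂ w (H2.shift F) = 0 := fun w hw F hF =>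
    (Submodule.mem_orthogonal' _ _).1 hw.2 _ ⟨F, hF, rfl⟩
  have hcard : ∀ (s : Finset W), LinearIndependent ℂ (fun i : s => (i : W)) → s.card ≤ m := by
    intro s hs
    set P := (Submodule.span ℂ (s : Set W)).map W.subtype with hP
    have : FiniteDimensional ℂ (Submodule.span ℂ (s : Set W)) := FiniteDimensional.span_finset ℂ s
    have hfr : Module.finrank ℂ P = s.card :=
      (LinearEquiv.finrank_eq (Submodule.equivMapOfInjective W.subtype W.injective_subtype _)).symm
        |>.trans (finrank_span_finset_eq_card hs)
    have : FiniteDimensional ℂ P := Module.Finite.map _ _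
    let V : Cn (Module.finrank ℂ P) →ₗᵢ[ℂ] H2 (Cn m) :=
      P.subtypeₗᵢ.comp (stdOrthonormalBasis ℂ P).repr.symm.toLinearIsometry
    rw [← hfr]
    have hVW : ∀ c, V c ∈ W := fun c =>
      Submodule.map_subtype_le W _ ((stdOrthonormalBasis ℂ P).repr.symm c : P).2
    exact le_of_wandering hN V (fun c => (hVW c).1) fun c => hWo _ (hVW c)
  have hrank : Module.rank ℂ W ≤ m := rank_le hcard
  have : FiniteDimensional ℂ W :=
    Module.rank_lt_aleph0_iff.1 (hrank.trans_lt (Cardinal.natCast_lt_aleph0))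
  let V : Cn (Module.finrank ℂ W) →ₗᵢ[ℂ] H2 (Cn m) :=
    W.subtypeₗᵢ.comp (stdOrthonormalBasis ℂ W).repr.symm.toLinearIsometry
  have hVW : ∀ c, V c ∈ W := fun c => ((stdOrthonormalBasis ℂ W).repr.symm c : W).2
  refine ⟨Module.finrank ℂ W,
    le_of_wandering hN V (fun c => (hVW c).1) fun c => hWo _ (hVW c), ?_⟩
  obtain ⟨X, hX, hXr⟩ := exists_isometry_of_wandering (S := S) hN V (fun c => (hVW c).1)
    fun c => hWo _ (hVW c)
  refine ⟨X, hX, hXr.trans (eq_closure_iSup_range_of_wandering ?_ hNc hN V ?_)⟩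
  · intro F hF
    refine H2.eq_zero_of_forall_mem_range_shift_pow fun k => ?_
    obtain ⟨G, hG⟩ := hF k
    exact ⟨G, by rw [← hG, shiftₗᵢ_pow_apply]⟩
  · intro F
    refine ⟨?_, fun hF => ⟨(stdOrthonormalBasis ℂ W).repr ⟨F, hF⟩, ?_⟩⟩
    · rintro ⟨c, rfl⟩
      exact hVW c
    · change ((((stdOrthonormalBasis ℂ W).repr.symm
        ((stdOrthonormalBasis ℂ W).repr ⟨F, hF⟩) : W)) : H2 (Cn m)) = F
      rw [LinearIsometryEquiv.symm_apply_apply]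

end BeurlingLaxHalmos

/-! ### The matrix function `Σ` -/

section Sigma

/-- Multiplication by a function in `H^∞` maps `H²` to itself. -/
lemma MemHInf.exists_mul {r n : ℕ} {Φ : ℂ → Cn r →L[ℂ] Cn n} (h : MemHInf Φ) (F : H2 (Cn r)) :
    ∃ G : H2 (Cn n), ∀ z ∈ Metric.ball (0 : ℂ) 1, G z = Φ z (F z) := by
  obtain ⟨hd, C, hC⟩ := h
  set g : ℂ → Cn n := (Metric.ball (0 : ℂ) 1).indicator fun z => Φ z (F z) with hg
  have hgd : DifferentiableOn ℂ g (Metric.ball 0 1) :=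
    (hd.clm_apply F.differentiableOn).congr fun z hz => indicator_of_mem hz _
  refine ⟨⟨g, hgd, fun z hz => indicator_of_notMem hz _, C ^ 2 * ‖F‖ ^ 2, ?_⟩,
    fun z hz => indicator_of_mem hz (fun z => Φ z (F z))⟩
  rintro _ ⟨ρ, rfl⟩
  have h1 := meanSq_le hgd F.differentiableOn F.differentiableOn (a := C ^ 2) (b := 0)
    (fun z hz => by
      rw [zero_mul, add_zero, ← mul_pow, hg, indicator_of_mem hz]
      gcongr
      exact (Φ z).le_of_opNorm_le (hC z hz) _) ρ.2
  have h2 := H2.meanSq_le_norm_sq F ρ.2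
  change meanSq g ρ ≤ _
  nlinarith [sq_nonneg C]

variable {m γ : ℕ}

lemma toEuclideanCLM_sigmaMatrix_apply (k : ℕ) (z : ℂ) (c : Cn m) (i : Fin m) :
    Matrix.toEuclideanCLM (𝕜 := ℂ) (sigmaMatrix m γ k z) c i
      = ∑ j, sigmaMatrix m γ k z i j * c j := rfl

lemma differentiable_toEuclideanCLM_sigmaMatrix (k : ℕ) :
    Differentiable ℂ fun z => (Matrix.toEuclideanCLM (𝕜 := ℂ) (sigmaMatrix m γ k z)) := by
  rw [← differentiableOn_univ]
  refine differentiableOn_of_forall_apply fun c => ?_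
  rw [differentiableOn_univ, differentiable_euclidean]
  intro i
  simp only [toEuclideanCLM_sigmaMatrix_apply]
  refine Differentiable.fun_sum fun j _ => Differentiable.mul_const ?_ _
  simp only [sigmaMatrix, Matrix.of_apply]
  split_ifs <;> fun_prop

lemma memHInf_sigmaMatrix (k : ℕ) :
    MemHInf fun z => Matrix.toEuclideanCLM (𝕜 := ℂ) (sigmaMatrix m γ k z) := by
  have hd := differentiable_toEuclideanCLM_sigmaMatrix (m := m) (γ := γ) k
  obtain ⟨C, hC⟩ := (isCompact_closedBall (0 : ℂ) 1).exists_bound_of_continuousOn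
    hd.continuous.continuousOn
  exact ⟨hd.differentiableOn, C, fun z hz => hC z (Metric.ball_subset_closedBall hz)⟩

/-- `Σ(zᵐ)` acts on the interleaved coordinates as multiplication by `z^{km+γ}`. -/
lemma sum_pow_mul_sigmaMatrix (hγm : γ < m) (k : ℕ) (z : ℂ) (c : Cn m) :
    ∑ i : Fin m, z ^ (i : ℕ) * Matrix.toEuclideanCLM (𝕜 := ℂ) (sigmaMatrix m γ k (z ^ m)) c i
      = z ^ (k * m + γ) * ∑ j : Fin m, z ^ (j : ℕ) * c j := by
  simp only [toEuclideanCLM_sigmaMatrix_apply, Finset.mul_sum]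
  rw [Finset.sum_comm]
  refine Finset.sum_congr rfl fun j _ => ?_
  -- the single nonzero entry of column `j` sits in the row `j + γ` modulo `m`
  by_cases hj : (j : ℕ) + γ < m
  · rw [Finset.sum_eq_single ⟨j + γ, hj⟩]
    · have h1 : ¬ ((j : ℕ) + γ = j + γ + m) := by omega
      simp only [sigmaMatrix, Matrix.of_apply, h1, if_false, if_true, ← pow_mul]
      rw [← mul_assoc, ← mul_assoc, ← pow_add, ← pow_add]
      congr 2
      ring
    · intro i _ hi
      have h1 : ¬ ((j : ℕ) + γ = i + m) := by omega
      have h2 : ¬ ((i : ℕ) = j + γ) := fun h => hi (Fin.ext h)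
      simp [sigmaMatrix, h1, h2]
    · simp
  · have hjm := j.2
    rw [Finset.sum_eq_single ⟨j + γ - m, by omega⟩]
    · have h1 : (j : ℕ) + γ = j + γ - m + m := by omega
      have h2 : (z ^ m) ^ (k + 1) = z ^ (m + k * m) := by rw [← pow_mul]; congr 1; ring
      simp only [sigmaMatrix, Matrix.of_apply, ← h1, if_true, h2]
      rw [← mul_assoc, ← mul_assoc, ← pow_add, ← pow_add]
      congr 2
      omega
    · intro i _ hi
      have h1 : ¬ ((j : ℕ) + γ = i + m) := fun h => hi (Fin.ext (by simp only; omega))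
      have h2 : ¬ ((i : ℕ) = j + γ) := by omega
      simp [sigmaMatrix, h1, h2]
    · simp

/-- The intertwining relation `Θ Ψ = A Θ` on the disc determines the boundary values of `Ψ`, since
those of `Θ` are isometries. -/
lemma adjoint_comp_boundaryValue_eq {r m : ℕ} {Θ : ℂ → Cn r →L[ℂ] Cn m} {Ψ : ℂ → Cn r →L[ℂ] Cn r}
    {A : ℂ → Cn m →L[ℂ] Cn m}
    (hcomm : ∀ z ∈ Metric.ball (0 : ℂ) 1, Θ z ∘L Ψ z = A z ∘L Θ z) (hA : Continuous A) {t : ℝ}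
    {L : Cn r →L[ℂ] Cn m} {P : Cn r →L[ℂ] Cn r} (hL : HasBoundaryValue Θ t L)
    (hP : HasBoundaryValue Ψ t P) (hLi : Isometry L) :
    L.adjoint ∘L A (circleMap 0 1 t) ∘L L = P := by
  have hA' : HasBoundaryValue A t (A (circleMap 0 1 t)) := by
    have h1 : Continuous fun ρ : ℝ => A (circleMap 0 ρ t) :=
      hA.comp (by unfold circleMap; fun_prop)
    exact (h1.tendsto 1).mono_left nhdsWithin_le_nhds
  have happ : ∀ {p q : ℕ} {Φ : ℂ → Cn p →L[ℂ] Cn q} {Q : Cn p →L[ℂ] Cn q} {f : ℝ → Cn p} {c : Cn p},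
      HasBoundaryValue Φ t Q → Tendsto f (𝓝[<] 1) (𝓝 c) →
      Tendsto (fun ρ : ℝ => Φ (circleMap 0 ρ t) (f ρ)) (𝓝[<] 1) (𝓝 (Q c)) := fun hQ hf =>
    (isBoundedBilinearMap_apply.continuous.tendsto (_, _)).comp (hQ.prodMk_nhds hf)
  have h3 : L ∘L P = A (circleMap 0 1 t) ∘L L := by
    ext1 c
    have h1 : Tendsto (fun ρ : ℝ => Θ (circleMap 0 ρ t) (Ψ (circleMap 0 ρ t) c)) (𝓝[<] 1)
        (𝓝 (L (P c))) := happ hL (happ hP tendsto_const_nhds)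
    have h2 : Tendsto (fun ρ : ℝ => A (circleMap 0 ρ t) (Θ (circleMap 0 ρ t) c)) (𝓝[<] 1)
        (𝓝 (A (circleMap 0 1 t) (L c))) := happ hA' (happ hL tendsto_const_nhds)
    refine tendsto_nhds_unique h1 (h2.congr' ?_)
    filter_upwards [Ioo_mem_nhdsLT (zero_lt_one (α := ℝ))] with ρ hρ
    have hmem : circleMap 0 ρ t ∈ Metric.ball (0 : ℂ) 1 := by simpa [abs_of_pos hρ.1] using hρ.2
    exact (DFunLike.congr_fun (hcomm _ hmem) c).symm
  have h4 : L.adjoint ∘L L = 1 :=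
    (ContinuousLinearMap.norm_map_iff_adjoint_comp_self L).1
      ((AddMonoidHomClass.isometry_iff_norm L).1 hLi)
  rw [← h3, ← ContinuousLinearMap.comp_assoc, h4]
  exact ContinuousLinearMap.id_comp P

end Sigma

end Hardy

end

open Hardy

theorem mainTheorem1 (m k γ : ℕ) (hm : 3 ≤ m) (hk : 1 ≤ k) (hγ : 1 ≤ γ) (hγm : γ < m) :
    ∃ T : Hardy.H2 (Hardy.Cn m) ≃ₗᵢ[ℂ] Hardy.H2 ℂ,
      (∀ F : Hardy.H2 (Hardy.Cn m), ∀ z ∈ Metric.ball (0 : ℂ) 1,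
        T F z = ∑ l : Fin m, z ^ (l : ℕ) * F (z ^ m) l) ∧
      ∀ M : Submodule ℂ (Hardy.H2 ℂ), IsClosed (M : Set (Hardy.H2 ℂ)) →
        (∀ f ∈ M, (Hardy.H2.shift ^ m) f ∈ M) →
        (∀ f ∈ M, (Hardy.H2.shift ^ (k * m + γ)) f ∈ M) →
        ∃ r : ℕ, r ≤ m ∧ ∃ Θ : ℂ → Hardy.Cn r →L[ℂ] Hardy.Cn m,
          Hardy.IsInner Θ ∧ Hardy.SigmaCompressionMemHInf γ k Θ ∧
          (M : Set (Hardy.H2 ℂ)) = T '' Hardy.mulRange Θ := by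
  have : NeZero m := ⟨by omega⟩
  set T := H2.interleaveEquiv m with hT
  refine ⟨T, fun F z hz => H2.interleaveEquiv_apply F hz, fun M hMc hMm hMk => ?_⟩
  set N : Submodule ℂ (H2 (Cn m)) := M.comap (T : H2 (Cn m) →ₗ[ℂ] H2 ℂ) with hN
  have hNM : ∀ F, F ∈ N ↔ T F ∈ M := fun F => Iff.rfl
  have hNc : IsClosed (N : Set (H2 (Cn m))) := hMc.preimage T.continuous
  have hNs : ∀ F ∈ N, H2.shift F ∈ N := by
    intro F hF
    rw [hNM, hT, H2.interleaveEquiv_shift]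
    exact hMm _ hF
  obtain ⟨r, hr, X, hX, hXr⟩ := exists_isometry_range_eq hNc hNs
  obtain ⟨Θ, hΘd, hΘb, hΘ⟩ := exists_multiplier X hX
  have hXN : ∀ F, X F ∈ N := fun F => by rw [← hXr]; exact ⟨F, rfl⟩
  have hin : IsInner Θ := isInner_of_isometry hΘd hΘb fun c =>
    ⟨X (H2.const _ c), by simp, fun z hz => by rw [hΘ _ z hz, H2.const_apply c hz]⟩
  refine ⟨r, hr, Θ, hin, ?_, ?_⟩
  · -- multiplication by `Σ` on `H²(𝔻, ℂᵐ)`, transported from the power of the shift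
    set A : ℂ → Cn m →L[ℂ] Cn m := fun z =>
      Matrix.toEuclideanCLM (𝕜 := ℂ) (sigmaMatrix m γ k z) with hA
    set B : H2 (Cn m) → H2 (Cn m) := fun G => T.symm ((H2.shift ^ (k * m + γ)) (T G)) with hB
    have hTB : ∀ G, T (B G) = (H2.shift ^ (k * m + γ)) (T G) := fun G => T.apply_symm_apply _
    have hBs : ∀ G, B (H2.shift G) = H2.shift (B G) := by
      intro G
      apply T.injective
      rw [hTB, hT, H2.interleaveEquiv_shift, H2.interleaveEquiv_shift, ← hT, hTB,
        ← Module.End.mul_apply, ← Module.End.mul_apply, ← pow_add, ← pow_add, add_comm]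
    have hBA : ∀ G, ∀ z ∈ Metric.ball (0 : ℂ) 1, B G z = A z (G z) := by
      intro G
      obtain ⟨G', hG'⟩ := (memHInf_sigmaMatrix (m := m) (γ := γ) k).exists_mul G
      suffices h : B G = G' by rw [h]; exact hG'
      apply T.injective
      rw [hTB]
      ext z hz
      rw [H2.shift_pow_apply, hT, H2.interleaveEquiv_apply _ hz, H2.interleaveEquiv_apply _ hz,
        smul_eq_mul, ← sum_pow_mul_sigmaMatrix hγm, hG' _ (H2.pow_mem_unitBall hz)]
    have hBN : ∀ F, B (X F) ∈ LinearMap.range X.toLinearMap := by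
      intro F
      rw [hXr, hNM, hTB]
      exact hMk _ (hXN F)
    have hY : ∀ F, ∃ G, X G = B (X F) := hBN
    choose Y hY using hY
    let Y' : H2 (Cn r) →ₗᵢ[ℂ] H2 (Cn r) :=
      { toFun := Y
        map_add' := fun F G => X.injective (by simp [hY, hB])
        map_smul' := fun c F => X.injective (by simp [hY, hB])
        norm_map' := fun F => by
          change ‖Y F‖ = ‖F‖
          rw [← X.norm_map, hY, ← T.norm_map, hTB, H2.norm_shift_pow, T.norm_map, X.norm_map] }
    have hYs : ∀ F, Y' (H2.shift F) = H2.shift (Y' F) := fun F => X.injective (by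
      change X (Y (H2.shift F)) = X (H2.shift (Y F))
      rw [hY, hX, hBs, hX, hY])
    obtain ⟨Ψ, hΨd, hΨb, hΨ⟩ := exists_multiplier Y' hYs
    have hcomm : ∀ z ∈ Metric.ball (0 : ℂ) 1, Θ z ∘L Ψ z = A z ∘L Θ z := by
      intro z hz
      ext1 c
      have h1 : X (Y (H2.const _ c)) z = B (X (H2.const _ c)) z := by rw [hY]
      rw [hBA _ z hz, hΘ _ z hz, hΘ _ z hz] at h1
      have h2 : Y (H2.const _ c) z = Ψ z c := by
        have := hΨ (H2.const _ c) z hz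
        rwa [H2.const_apply c hz] at this
      rw [h2, H2.const_apply c hz] at h1
      exact h1
    refine ⟨Ψ, ⟨hΨd, 1, hΨb⟩, ?_⟩
    filter_upwards [hin.2, ae_exists_tendsto_radial hΨd hΨb] with t ⟨L, hL, hLi⟩ ⟨P, hP⟩
    have h := adjoint_comp_boundaryValue_eq hcomm
      (differentiable_toEuclideanCLM_sigmaMatrix (m := m) (γ := γ) k).continuous hL hP hLi
    refine ⟨L, hL, ?_⟩
    rw [← h] at hP
    exact hP
  · have hmul : mulRange Θ = (N : Set (H2 (Cn m))) := by
      ext G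
      rw [← hXr]
      constructor
      · rintro ⟨F, hF⟩
        exact ⟨F, H2.ext fun z hz => (hΘ F z hz).trans (hF z hz).symm⟩
      · rintro ⟨F, rfl⟩
        exact ⟨F, hΘ F⟩
    rw [hmul]
    ext f
    constructor
    · intro hf
      exact ⟨T.symm f, by simpa [hNM] using hf, T.apply_symm_apply f⟩
    · rintro ⟨F, hF, rfl⟩
      exact hF
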